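/- Let $n\ge 1$ and let $g:[0,\infty)^n\to\mathbb{R}$ be a continuous function such that $g(t)=0$ whenever $t\in[0,\infty)^n$ has at least one coordinate equal to $0$. A function $h:(0,\infty)^n\to\mathbb{R}$ is called completely monotone with $n$ variables if $h\in C^\infty((0,\infty)^n)$ and $(-1)^{|\alpha|}\partial^\alpha h(t)\ge 0$ for all $\alpha\in\mathbb{Z}_+^n$ and $t\in(0,\infty)^n$. The function $g$ is called a Bernstein function of order $n$ in $(0,\infty)^n$ if $g\in C^\infty((0,\infty)^n)$ and $\partial^{\vec 1}g=\partial_{1}\cdots\partial_{n}g$ is completely monotone with $n$ variables on $(0,\infty)^n$. Then $g$ is a Bernstein function of order $n$ in $(0,\infty)^n$ if and only if there is a finite nonnegative Borel measure $\eta$ on $[0,\infty)^n$ such that, for every $t\in[0,\infty)^n$, $$ g(t)=\int_{[0,\infty)^n}\prod_{i=1}^n (1-e^{-r_it_i})\frac{1+r_i}{r_i}\,d\eta(r), $$ where the integral converges absolutely and the value of $(1-e^{-rs})(1+r)/r$ at $r=0$ is defined as its limit $s$. Moreover, the representation is unique: at most one finite nonnegative Borel measure $\eta$ on $[0,\infty)^n$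 represents $g$ in this way. -/

import Mathlib

open MeasureTheory
open scoped NNReal ContDiff

noncomputable section

/-- The closed orthant `[0, ∞)^n`. -/
def closedOrthant (n : ℕ) : Set (Fin n → ℝ) := {t | ∀ i, 0 ≤ t i}

/-- The open orthant `(0, ∞)^n`. -/
def openOrthant (n : ℕ) : Set (Fin n → ℝ) := {t | ∀ i, 0 < t i}

/-- The set `∂_{n-1}^n` of the points of `[0, ∞)^n` with at least one coordinate equal to zero. -/
def orthantBoundary (n : ℕ) : Set (Fin n → ℝ) := {t | t ∈ closedOrthant n ∧ ∃ i, t i = 0}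

/-- The partial derivative of `h` in the `i`-th variable. -/
def partialDeriv {n : ℕ} (i : Fin n) (h : (Fin n → ℝ) → ℝ) : (Fin n → ℝ) → ℝ :=
  fun t => deriv (fun s => h (Function.update t i s)) (t i)

/-- The mixed partial derivative `∂^α h = ∂_0^{α 0} ⋯ ∂_{n-1}^{α (n-1)} h`. -/
def mixedPartial {n : ℕ} (α : Fin n → ℕ) (h : (Fin n → ℝ) → ℝ) : (Fin n → ℝ) → ℝ :=
  (List.finRange n).foldr (fun i f => (partialDeriv i)^[α i] f) h

/-- `h` is completely monotone with `n` variables on `(0, ∞)^n`. Only the values of `h` on the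
open orthant matter. -/
def IsCompletelyMonotone {n : ℕ} (h : (Fin n → ℝ) → ℝ) : Prop :=
  ContDiffOn ℝ ∞ h (openOrthant n) ∧
    ∀ α : Fin n → ℕ, ∀ t ∈ openOrthant n, 0 ≤ (-1 : ℝ) ^ (∑ i, α i) * mixedPartial α h t

/-- `g` is a Bernstein function of order `n` in `(0, ∞)^n`: it is smooth there and its derivative
`∂^{(1, …, 1)} g` is completely monotone. Only the values of `g` on the open orthant matter. -/
def IsBernsteinOfOrderN {n : ℕ} (g : (Fin n → ℝ) → ℝ) : Prop :=
  ContDiffOn ℝ ∞ g (openOrthant n) ∧ IsCompletelyMonotone (mixedPartial (fun _ => 1) g)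

/-- The function `(1 - e^{-r t}) (1 + r) / r`, with its limit `t` as the value at `r = 0`. -/
def bernsteinKernel (r t : ℝ) : ℝ :=
  if r = 0 then t else (1 - Real.exp (-(r * t))) * ((1 + r) / r)

/-- The measure `η` on `[0, ∞)^n` represents `g` on `[0, ∞)^n`:
`g t = ∫ ∏ i, (1 - e^{-r_i t_i}) (1 + r_i) / r_i dη(r)`, with a convergent integral. -/
def Represents {n : ℕ} (η : Measure (Fin n → ℝ≥0)) (g : (Fin n → ℝ) → ℝ) : Prop :=
  ∀ t ∈ closedOrthant n,
    Integrable (fun r : Fin n → ℝ≥0 => ∏ i, bernsteinKernel (r i) (t i)) η ∧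
      g t = ∫ r : Fin n → ℝ≥0, ∏ i, bernsteinKernel (r i) (t i) ∂η

end

/-! The hard direction is a Choquet-type argument via the Krein–Milman theorem. Replace derivatives
by finite differences: `bernsteinCone` consists of the functions vanishing on the boundary whose
mixed box differences keep a nonnegative sign under any further backward differences. These
conditions are linear and pointwise closed. A member is bounded at each point by a constant times
its value at `(1, …, 1)`, so the base `bernsteinBase`, normalized by `f 1 = 1`, is convex and
compact for pointwise convergence.

For each variable `i` and step `s`, `f` splits as `shiftOp i s f + (f - shiftOp i s f)` with both
summands in the cone. Hence an extreme `f` is an eigenvector of every `shiftOp i s`. The resulting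
functional equations force `f t = ∏ i, (1 - y_i ^ t_i) / (1 - y_i)` with `y` in the unit cube
(`extremePoints_bernsteinBase`). The probability mixtures of these products form a compact convex
set, which therefore contains the base. Continuity of `g` at the boundary excludes `y_i = 0`, and
`r_i = -log y_i` with a change of density turns the mixture into the required integral.

Conversely, the integral may be differentiated under the sign, and the derivatives of the kernel
have the right signs. For uniqueness, the box difference of `g` with unit sides is the Laplace
transform of `η` weighted by a positive function, and a finite measure is determined by its Laplace
transform. -/

/-! ### Difference operators as a commutative algebra of translations -/

/-- The algebra of formal combinations of translations by elements of `T`, acting on the real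
functions on a monoid `X` over `T`. -/
noncomputable def translationAction {T X : Type*} [AddCommMonoid T] [AddCommMonoid X] (φ : T →+ X) :
    AddMonoidAlgebra ℝ T →ₐ[ℝ] Module.End ℝ (X → ℝ) :=
  AddMonoidAlgebra.lift ℝ (Module.End ℝ (X → ℝ)) T
    { toFun := fun a => LinearMap.funLeft ℝ ℝ (fun x => x + φ a.toAdd)
      map_one' := by ext f x; simp [LinearMap.funLeft]
      map_mul' := fun a b => by
        ext f x
        simp [LinearMap.funLeft, add_assoc] }

section action
variable {T X : Type*} [AddCommMonoid T] [AddCommMonoid X] (φ : T →+ X)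

theorem translationAction_single (a : T) (c : ℝ) (f : X → ℝ) (x : X) :
    translationAction φ (AddMonoidAlgebra.single a c) f x = c * f (x + φ a) := by
  simp [translationAction, AddMonoidAlgebra.lift_single, LinearMap.funLeft]

/-- Transfers differences between functions of `ℝ≥0` coordinates, where the cone lives, and
functions on `ℝ^n`, where derivatives are taken. -/
theorem translationAction_comp (P : AddMonoidAlgebra ℝ T) (f : X → ℝ) (t : T) :
    translationAction (AddMonoidHom.id T) P (f ∘ φ) t = translationAction φ P f (φ t) := by
  induction P using AddMonoidAlgebra.induction_linear with
  | zero => simp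
  | add P Q hP hQ => simp [hP, hQ]
  | single a c => simp [translationAction_single]

theorem continuous_translationAction [TopologicalSpace X] [ContinuousAdd X]
    (P : AddMonoidAlgebra ℝ T) {f : X → ℝ} (hf : Continuous f) :
    Continuous (translationAction φ P f) := by
  induction P using AddMonoidAlgebra.induction_linear with
  | zero => simpa using continuous_zero
  | add P Q hP hQ => simpa using hP.add hQ
  | single a c =>
    have : translationAction φ (AddMonoidAlgebra.single a c) f = fun x => c * f (x + φ a) := by
      ext x; exact translationAction_single φ a c f x
    rw [this]
    fun_prop

theorem continuous_translationAction_apply (P : AddMonoidAlgebra ℝ T) (x : X) :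
    Continuous fun f : X → ℝ => translationAction φ P f x := by
  induction P using AddMonoidAlgebra.induction_linear with
  | zero => simpa using continuous_const
  | add P Q hP hQ => simpa using! hP.add hQ
  | single a c => simp only [translationAction_single]; fun_prop

end action

/-! ### The cone, its compact base and its extreme points -/

section cone
variable {n : ℕ}

/-- The forward difference with step `s` in the `i`-th variable. -/
noncomputable def diffElt (i : Fin n) (s : ℝ≥0) : AddMonoidAlgebra ℝ (Fin n → ℝ≥0) :=
  AddMonoidAlgebra.single (Pi.single i s) 1 - 1

/-- The mixed difference over the box with side lengths `u`. -/
noncomputable def boxElt (u : Fin n → ℝ≥0) : AddMonoidAlgebra ℝ (Fin n → ℝ≥0) :=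
  ∏ i, diffElt i (u i)

/-- The product of the backward differences in a list of variables and steps. -/
noncomputable def altElt (l : List (Fin n × ℝ≥0)) : AddMonoidAlgebra ℝ (Fin n → ℝ≥0) :=
  (l.map fun p => -diffElt p.1 p.2).prod

/-- The action on the functions on the closed orthant. -/
noncomputable abbrev act (P : AddMonoidAlgebra ℝ (Fin n → ℝ≥0)) :
    Module.End ℝ ((Fin n → ℝ≥0) → ℝ) :=
  translationAction (AddMonoidHom.id (Fin n → ℝ≥0)) P

theorem act_single (a : Fin n → ℝ≥0) (f : (Fin n → ℝ≥0) → ℝ) (t : Fin n → ℝ≥0) :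
    act (AddMonoidAlgebra.single a 1) f t = f (t + a) := by
  simp [act, translationAction_single]

theorem act_diffElt (i : Fin n) (s : ℝ≥0) (f : (Fin n → ℝ≥0) → ℝ) (t : Fin n → ℝ≥0) :
    act (diffElt i s) f t = f (t + Pi.single i s) - f t := by
  simp [act, diffElt, translationAction_single]

theorem act_mul (P Q : AddMonoidAlgebra ℝ (Fin n → ℝ≥0)) (f : (Fin n → ℝ≥0) → ℝ) :
    act (P * Q) f = act P (act Q f) := by
  simp [act]

theorem update_add_single (t : Fin n → ℝ≥0) (i : Fin n) (x s : ℝ≥0) :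
    Function.update t i x + Pi.single i s = Function.update t i (x + s) := by
  ext j
  by_cases h : j = i
  · subst h; simp
  · simp [h]

theorem add_single (t : Fin n → ℝ≥0) (i : Fin n) (s : ℝ≥0) :
    t + Pi.single i s = Function.update t i (t i + s) := by
  rw [← update_add_single, Function.update_eq_self]

/-- The cone of the functions on the closed orthant that vanish on the boundary and have all
mixed box differences completely monotone in the sense of differences. -/
def bernsteinCone (n : ℕ) : Set ((Fin n → ℝ≥0) → ℝ) :=
  {f | (∀ t, (∃ i, t i = 0) → f t = 0) ∧ ∀ u l t, 0 ≤ act (altElt l * boxElt u) f t}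

/-- In a difference starting from a zero coordinate the subtracted term lies on the boundary, so
only the far corner survives. Thus values of `f` are themselves box differences at `0`, and
membership in the cone gives `0 ≤ f`. -/
theorem act_prod_diffElt_of_zero {f : (Fin n → ℝ≥0) → ℝ} (hf : ∀ t, (∃ i, t i = 0) → f t = 0)
    (u : Fin n → ℝ≥0) (S : Finset (Fin n)) (t : Fin n → ℝ≥0) (ht : ∀ i ∈ S, t i = 0) :
    act (∏ i ∈ S, diffElt i (u i)) f t = f (S.piecewise u t) := by
  induction S using Finset.induction_on generalizing t with
  | empty => simp [act]
  | insert j S hj ih =>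
    rw [Finset.prod_insert hj, act_mul, act_diffElt, ih, ih]
    · have h0 : f (S.piecewise u t) = 0 := hf _ ⟨j, by simp [hj, ht]⟩
      rw [h0, sub_zero, Finset.piecewise_insert, add_single, ht j (by simp), zero_add,
        Finset.update_piecewise_of_notMem _ _ _ hj]
    · exact fun i hi => ht i (by simp [hi])
    · intro i hi
      have : i ≠ j := fun h => hj (h ▸ hi)
      simp [this, ht i (by simp [hi])]

theorem act_boxElt_zero {f : (Fin n → ℝ≥0) → ℝ} (hf : ∀ t, (∃ i, t i = 0) → f t = 0)
    (u : Fin n → ℝ≥0) : act (boxElt u) f 0 = f u := by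
  rw [boxElt, act_prod_diffElt_of_zero hf u _ 0 (by simp)]
  simp

theorem bernsteinCone_nonneg {f : (Fin n → ℝ≥0) → ℝ} (hf : f ∈ bernsteinCone n)
    (u : Fin n → ℝ≥0) : 0 ≤ f u := by
  have := hf.2 u [] 0
  rwa [altElt, List.map_nil, List.prod_nil, one_mul, act_boxElt_zero hf.1] at this

theorem act_boxElt_const {f : (Fin n → ℝ≥0) → ℝ} (i : Fin n)
    (hf : ∀ t s, f (t + Pi.single i s) = f t) (u : Fin n → ℝ≥0) : act (boxElt u) f = 0 := by
  have : act (diffElt i (u i)) f = 0 := by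
    ext t; simp [act_diffElt, hf]
  rw [boxElt, ← Finset.prod_erase_mul _ _ (Finset.mem_univ i), act_mul, this, map_zero]

/-- The operator that becomes the shift by `s` in the `i`-th variable after a mixed difference,
corrected so as to vanish on the boundary. -/
def shiftOp (i : Fin n) (s : ℝ≥0) (f : (Fin n → ℝ≥0) → ℝ) : (Fin n → ℝ≥0) → ℝ :=
  fun t => f (t + Pi.single i s) - f (Function.update t i s)

/-- The correction term does not depend on the `i`-th coordinate, so the `i`-th difference kills it.
-/
theorem act_boxElt_shiftOp (i : Fin n) (s : ℝ≥0) (f : (Fin n → ℝ≥0) → ℝ) (u : Fin n → ℝ≥0) :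
    act (boxElt u) (shiftOp i s f) =
      act (AddMonoidAlgebra.single (Pi.single i s) 1) (act (boxElt u) f) := by
  have h : shiftOp i s f = act (AddMonoidAlgebra.single (Pi.single i s) 1) f -
      fun t => f (Function.update t i s) := by
    ext t; simp [shiftOp, act_single]
  rw [h, map_sub, act_boxElt_const i (f := fun t => f (Function.update t i s)), sub_zero,
    ← act_mul, ← act_mul, mul_comm]
  intro t s
  simp [add_single]

theorem shiftOp_eq_zero_of_boundary {f : (Fin n → ℝ≥0) → ℝ} (hf : ∀ t, (∃ i, t i = 0) → f t = 0)
    (i : Fin n) (s : ℝ≥0) (t : Fin n → ℝ≥0) (ht : ∃ j, t j = 0) : shiftOp i s f t = 0 := by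
  obtain ⟨j, hj⟩ := ht
  by_cases h : j = i
  · subst h; simp [shiftOp, add_single, hj]
  · rw [shiftOp, hf _ ⟨j, by simp [h, hj]⟩, hf _ ⟨j, by simp [h, hj]⟩, sub_zero]

theorem shiftOp_mem {f : (Fin n → ℝ≥0) → ℝ} (hf : f ∈ bernsteinCone n) (i : Fin n) (s : ℝ≥0) :
    shiftOp i s f ∈ bernsteinCone n := by
  refine ⟨shiftOp_eq_zero_of_boundary hf.1 i s, fun u l t => ?_⟩
  rw [act_mul, act_boxElt_shiftOp, ← act_mul, mul_comm, act_mul, act_single, ← act_mul]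
  exact hf.2 u l _

/-- Subtracting the shift amounts, after a box difference, to one more backward difference, which
the list in the definition of the cone can absorb. -/
theorem sub_shiftOp_mem {f : (Fin n → ℝ≥0) → ℝ} (hf : f ∈ bernsteinCone n) (i : Fin n) (s : ℝ≥0) :
    f - shiftOp i s f ∈ bernsteinCone n := by
  refine ⟨fun t ht => ?_, fun u l t => ?_⟩
  · rw [Pi.sub_apply, hf.1 t ht, shiftOp_eq_zero_of_boundary hf.1 i s t ht, sub_zero]
  · have := hf.2 u (l ++ [(i, s)]) t
    have h : act (boxElt u) (f - shiftOp i s f) = act (-diffElt i s) (act (boxElt u) f) := by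
      rw [map_sub, act_boxElt_shiftOp, diffElt, neg_sub]
      simp [act]
    rw [act_mul, h, ← act_mul, ← act_mul]
    simpa [altElt, mul_assoc] using this

theorem smul_mem_bernsteinCone {f : (Fin n → ℝ≥0) → ℝ} (hf : f ∈ bernsteinCone n) {c : ℝ}
    (hc : 0 ≤ c) : c • f ∈ bernsteinCone n := by
  refine ⟨fun t ht => by simp [hf.1 t ht], fun u l t => ?_⟩
  rw [map_smul]
  exact mul_nonneg hc (hf.2 u l t)

theorem add_mem_bernsteinCone {f f' : (Fin n → ℝ≥0) → ℝ} (hf : f ∈ bernsteinCone n)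
    (hf' : f' ∈ bernsteinCone n) : f + f' ∈ bernsteinCone n := by
  refine ⟨fun t ht => by simp [hf.1 t ht, hf'.1 t ht], fun u l t => ?_⟩
  rw [map_add]
  exact add_nonneg (hf.2 u l t) (hf'.2 u l t)

theorem isClosed_bernsteinCone : IsClosed (bernsteinCone n) := by
  rw [bernsteinCone, Set.ofPred_and]
  refine IsClosed.inter ?_ ?_
  · simp only [Set.ofPred_forall]
    exact isClosed_iInter fun t => isClosed_iInter fun _ =>
      isClosed_eq (continuous_apply t) continuous_const
  · simp only [Set.ofPred_forall]
    exact isClosed_iInter fun u => isClosed_iInter fun l => isClosed_iInter fun t =>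
      isClosed_le continuous_const (continuous_translationAction_apply _ _ _)

/-- Nonnegativity of `shiftOp i s f` is monotonicity in one variable; that of `f - shiftOp i s f` is
subadditivity, used next. -/
theorem bernsteinCone_le_update_add {f : (Fin n → ℝ≥0) → ℝ} (hf : f ∈ bernsteinCone n)
    (i : Fin n) (t : Fin n → ℝ≥0) (x s : ℝ≥0) :
    f (Function.update t i s) ≤ f (Function.update t i (x + s)) := by
  have := bernsteinCone_nonneg (shiftOp_mem hf i s) (Function.update t i x)
  simpa [shiftOp, update_add_single] using this

theorem bernsteinCone_update_add_le {f : (Fin n → ℝ≥0) → ℝ} (hf : f ∈ bernsteinCone n)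
    (i : Fin n) (t : Fin n → ℝ≥0) (x s : ℝ≥0) :
    f (Function.update t i (x + s)) ≤ f (Function.update t i x) + f (Function.update t i s) := by
  have := bernsteinCone_nonneg (sub_shiftOp_mem hf i s) (Function.update t i x)
  simp only [shiftOp, update_add_single, Pi.sub_apply, Function.update_idem] at this
  linarith

theorem bernsteinCone_update_le {f : (Fin n → ℝ≥0) → ℝ} (hf : f ∈ bernsteinCone n)
    (i : Fin n) (t : Fin n → ℝ≥0) (x : ℝ≥0) :
    f (Function.update t i x) ≤ ⌈x⌉₊ * f (Function.update t i 1) := by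
  have key : ∀ k : ℕ, f (Function.update t i k) ≤ k * f (Function.update t i 1) := by
    intro k
    induction k with
    | zero => simp [hf.1 (Function.update t i 0) ⟨i, by simp⟩]
    | succ k ih =>
      have := bernsteinCone_update_add_le hf i t k 1
      push_cast
      linarith
  refine le_trans ?_ (key _)
  have := bernsteinCone_le_update_add hf i t (⌈x⌉₊ - x) x
  rwa [tsub_add_cancel_of_le (Nat.le_ceil x)] at this

/-- Subadditivity and monotonicity, one coordinate at a time. The bound depends on `f` only through
`f 1`, so it gives compactness of the base by Tychonoff and shows that `f 1 = 0` forces `f = 0`. -/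
theorem bernsteinCone_le_prod {f : (Fin n → ℝ≥0) → ℝ} (hf : f ∈ bernsteinCone n)
    (t : Fin n → ℝ≥0) : f t ≤ (∏ i, (⌈t i⌉₊ : ℝ)) * f 1 := by
  have key : ∀ S : Finset (Fin n), f t ≤ (∏ i ∈ S, (⌈t i⌉₊ : ℝ)) * f (S.piecewise 1 t) := by
    intro S
    induction S using Finset.induction_on with
    | empty => simp
    | insert j S hj ih =>
      refine ih.trans ?_
      rw [Finset.prod_insert hj, Finset.piecewise_insert, mul_comm (⌈t j⌉₊ : ℝ), mul_assoc]
      refine mul_le_mul_of_nonneg_left ?_ (by positivity)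
      have := bernsteinCone_update_le hf j (S.piecewise 1 t) (t j)
      rwa [show Function.update (S.piecewise 1 t) j (t j) = S.piecewise 1 t by
        rw [Function.update_eq_iff]; simp [hj]] at this
  simpa using key Finset.univ

/-- The base of the cone. -/
def bernsteinBase (n : ℕ) : Set ((Fin n → ℝ≥0) → ℝ) := {f ∈ bernsteinCone n | f 1 = 1}

theorem isCompact_bernsteinBase : IsCompact (bernsteinBase n) := by
  refine IsCompact.of_isClosed_subset
    (isCompact_univ_pi fun t : Fin n → ℝ≥0 => isCompact_Icc (a := (0 : ℝ))
      (b := ∏ i, (⌈t i⌉₊ : ℝ))) ?_ ?_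
  · exact isClosed_bernsteinCone.inter (isClosed_eq (continuous_apply 1) continuous_const)
  · rintro f ⟨hf, h1⟩ t -
    refine ⟨bernsteinCone_nonneg hf t, ?_⟩
    simpa [h1] using bernsteinCone_le_prod hf t

theorem convex_bernsteinBase : Convex ℝ (bernsteinBase n) := by
  rintro f ⟨hf, hf1⟩ g ⟨hg, hg1⟩ a b ha hb hab
  refine ⟨add_mem_bernsteinCone (smul_mem_bernsteinCone hf ha) (smul_mem_bernsteinCone hg hb), ?_⟩
  simp [hf1, hg1, hab]

theorem eq_zero_of_mem_bernsteinCone {f : (Fin n → ℝ≥0) → ℝ} (hf : f ∈ bernsteinCone n)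
    (h1 : f 1 = 0) : f = 0 := by
  ext t
  have := bernsteinCone_le_prod hf t
  rw [h1, mul_zero] at this
  exact le_antisymm this (bernsteinCone_nonneg hf t)

/-- An extreme point of the base is an eigenvector of the shift operators. -/
theorem shiftOp_eq_smul_of_mem_extremePoints {f : (Fin n → ℝ≥0) → ℝ}
    (hf : f ∈ (bernsteinBase n).extremePoints ℝ) (i : Fin n) (s : ℝ≥0) :
    shiftOp i s f = shiftOp i s f 1 • f := by
  obtain ⟨⟨hfC, hf1⟩, hext⟩ := hf
  set F := shiftOp i s f with hF
  set c := F 1 with hc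
  have hFm := shiftOp_mem hfC i s
  have hGm := sub_shiftOp_mem hfC i s
  have h0 : 0 ≤ c := bernsteinCone_nonneg hFm 1
  have h1 : 0 ≤ 1 - c := by simpa [hf1, ← hF] using bernsteinCone_nonneg hGm 1
  rcases h0.eq_or_lt with h | h
  · rw [← h, zero_smul]
    exact eq_zero_of_mem_bernsteinCone hFm h.symm
  rcases h1.eq_or_lt with h' | h'
  · have := eq_zero_of_mem_bernsteinCone hGm (by simp [hf1, ← hF, ← hc, ← h'])
    rw [show c = 1 by linarith, one_smul]
    exact (sub_eq_zero.1 this).symm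
  -- With `0 < c < 1`, `f = c • (c⁻¹ • F) + (1 - c) • ((1 - c)⁻¹ • (f - F))` is a proper convex
  -- combination of points of the base.
  have e : (c⁻¹ • F) = f := by
    refine hext (x₁ := c⁻¹ • F) (x₂ := (1 - c)⁻¹ • (f - F)) ?_ ?_ ?_
    · exact ⟨smul_mem_bernsteinCone hFm (by positivity), by simp [← hc, h.ne']⟩
    · exact ⟨smul_mem_bernsteinCone hGm (by positivity), by simp [hf1, ← hc, h'.ne']⟩
    · refine ⟨c, 1 - c, h, h', by ring, ?_⟩
      rw [smul_smul, smul_smul, mul_inv_cancel₀ h.ne', mul_inv_cancel₀ h'.ne']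
      simp
  rw [inv_smul_eq_iff₀ h.ne'] at e
  exact e

end cone

/-! ### Functional equations in one variable -/

theorem eq_mul_of_additive_of_nonneg {a : ℝ≥0 → ℝ} (hadd : ∀ x y, a (x + y) = a x + a y)
    (h0 : ∀ x, 0 ≤ a x) (x : ℝ≥0) : a x = x * a 1 := by
  have hz : a 0 = 0 := by have := hadd 0 0; simp at this; exact this
  have hmul : ∀ (k : ℕ) y, a (k * y) = k * a y := by
    intro k y
    induction k with
    | zero => simp [hz]
    | succ k ih => push_cast; rw [add_mul, hadd, ih]; simp; ring
  have hmono : ∀ {y z}, y ≤ z → a y ≤ a z := by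
    intro y z h
    have := hadd y (z - y)
    rw [add_tsub_cancel_of_le h] at this
    linarith [h0 (z - y)]
  -- Monotonicity traps `a (k * x)` and `k * x * a 1` between the same two consecutive multiples of
  -- `a 1`; the Archimedean property then finishes.
  have hk : ∀ k : ℕ, k * |a x - x * a 1| ≤ a 1 := by
    intro k
    have h1 := hmono (Nat.floor_le (zero_le (a := k * x)))
    have h2 := hmono (Nat.lt_floor_add_one (k * x)).le
    rw [hmul] at h1 h2
    have e1 := hmul ⌊k * x⌋₊ 1
    have e2 := hmul (⌊k * x⌋₊ + 1) 1
    push_cast at e1 e2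
    rw [mul_one] at e1 e2
    rw [e1] at h1
    rw [e2] at h2
    have f1 : ((⌊k * x⌋₊ : ℝ≥0) : ℝ) ≤ ((k * x : ℝ≥0) : ℝ) :=
      NNReal.coe_le_coe.2 (Nat.floor_le (zero_le (a := k * x)))
    have f2 : ((k * x : ℝ≥0) : ℝ) ≤ ((⌊k * x⌋₊ + 1 : ℝ≥0) : ℝ) :=
      NNReal.coe_le_coe.2 (Nat.lt_floor_add_one (k * x)).le
    push_cast at f1 f2
    have g1 := mul_le_mul_of_nonneg_right f1 (h0 1)
    have g2 := mul_le_mul_of_nonneg_right f2 (h0 1)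
    rw [← Nat.abs_cast k, ← abs_mul, abs_le]
    constructor <;> nlinarith
  by_contra hne
  have hpos : 0 < |a x - x * a 1| := abs_pos.2 (sub_ne_zero.2 hne)
  obtain ⟨k, hk'⟩ := exists_nat_gt (a 1 / |a x - x * a 1|)
  rw [div_lt_iff₀ hpos] at hk'
  exact absurd (hk k) (not_le.2 hk')

/-- A function on `[0, ∞)` with values in `[0, 1]` that turns sums into products is a power. -/
theorem eq_rpow_of_multiplicative {l : ℝ≥0 → ℝ} (hmul : ∀ x y, l (x + y) = l x * l y)
    (h0 : ∀ x, 0 ≤ l x) (h1 : ∀ x, l x ≤ 1) (hz : l 0 = 1) (s : ℝ≥0) :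
    l s = l 1 ^ (s : ℝ) := by
  have hpow : ∀ (k : ℕ) y, l (k * y) = l y ^ k := by
    intro k y
    induction k with
    | zero => simp [hz]
    | succ k ih => push_cast; rw [add_mul, hmul, ih, one_mul, pow_succ]
  -- If `l 1 = 0`, then `l` vanishes on `[1, ∞)`, so some power of `l s` is zero for each `s ≠ 0`;
  -- the convention `0 ^ 0 = 1` covers `s = 0`. Otherwise `l` is positive and `-log l` is additive.
  rcases (h0 1).eq_or_lt with h | h
  · rw [← h]
    rcases eq_or_ne s 0 with rfl | hs
    · simp [hz]
    · rw [Real.zero_rpow (by exact_mod_cast hs)]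
      obtain ⟨k, hk⟩ := exists_nat_ge (1 / s)
      rw [div_le_iff₀ (pos_iff_ne_zero.2 hs)] at hk
      have e := hmul 1 (k * s - 1)
      rw [add_tsub_cancel_of_le hk, hpow, ← h, zero_mul] at e
      exact eq_zero_of_pow_eq_zero e
  · have hpos : ∀ x, 0 < l x := by
      intro x
      have e := hmul x (⌈x⌉₊ - x)
      rw [add_tsub_cancel_of_le (Nat.le_ceil x), ← mul_one (⌈x⌉₊ : ℝ≥0), hpow] at e
      refine lt_of_le_of_ne (h0 x) fun hx => ?_
      rw [← hx, zero_mul] at e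
      exact (pow_pos h _).ne' e
    have := eq_mul_of_additive_of_nonneg (a := fun x => -Real.log (l x))
      (fun x y => by rw [hmul, Real.log_mul (hpos x).ne' (hpos y).ne']; ring)
      (fun x => neg_nonneg.2 (Real.log_nonpos (h0 x) (h1 x))) s
    rw [Real.rpow_def_of_pos h, ← Real.exp_log (hpos s)]
    congr 1
    linarith

/-- The continuous function of `y` with value `(1 - y ^ t) / (1 - y)` for `y ≠ 1`. -/
noncomputable def powSlope (y t : ℝ) : ℝ := dslope (fun y : ℝ => y ^ t) 1 y

theorem powSlope_one (t : ℝ) : powSlope 1 t = t := by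
  rw [powSlope, dslope_same, Real.deriv_rpow_const]
  simp

theorem powSlope_of_ne {y : ℝ} (hy : y ≠ 1) (t : ℝ) : powSlope y t = (1 - y ^ t) / (1 - y) := by
  rw [powSlope, dslope_of_ne _ hy, slope_def_field, Real.one_rpow, ← neg_sub, ← neg_sub 1 y,
    neg_div_neg_eq]

theorem continuous_powSlope {t : ℝ} (ht : 0 ≤ t) : Continuous fun y => powSlope y t := by
  rw [← continuousOn_univ]
  refine (continuousOn_dslope Filter.univ_mem).2
    ⟨(Real.continuous_rpow_const ht).continuousOn, ?_⟩
  exact Real.differentiableAt_rpow_const_of_ne t one_ne_zero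

theorem powSlope_nonneg {y t : ℝ} (hy : 0 ≤ y) (hy1 : y ≤ 1) (ht : 0 ≤ t) : 0 ≤ powSlope y t := by
  rcases eq_or_ne y 1 with rfl | h
  · rwa [powSlope_one]
  · rw [powSlope_of_ne h]
    exact div_nonneg (sub_nonneg.2 (Real.rpow_le_one hy hy1 ht)) (sub_nonneg.2 hy1)

theorem powSlope_right_one (y : ℝ) : powSlope y 1 = 1 := by
  rcases eq_or_ne y 1 with rfl | h
  · rw [powSlope_one]
  · rw [powSlope_of_ne h, Real.rpow_one, div_self (sub_ne_zero.2 h.symm)]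

/-- The value `y = 0` stands for `r = ∞`: the factor jumps from `0` at `t = 0` to `1`. -/
theorem powSlope_zero {t : ℝ} (ht : t ≠ 0) : powSlope 0 t = 1 := by
  rw [powSlope_of_ne zero_ne_one, Real.zero_rpow ht]; simp

/-- Expanding `F (1 + s)` in both orders gives `l s = 1 - (1 - l 1) * F s`. If `l 1 = 1`, then `F`
is additive, hence linear; otherwise `l` is multiplicative, hence a power. -/
theorem eq_powSlope_of_shift {F l : ℝ≥0 → ℝ} (hF : ∀ x, 0 ≤ F x) (hF1 : F 1 = 1)
    (hF0 : F 0 = 0) (h : ∀ x s, F (x + s) = F s + l s * F x) (h0 : ∀ s, 0 ≤ l s) (h1 : ∀ s, l s ≤ 1) (x : ℝ≥0) :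
    F x = powSlope (l 1) x := by
  have hl : ∀ s, l s = 1 - (1 - l 1) * F s := by
    intro s
    have e1 := h 1 s
    have e2 := h s 1
    rw [add_comm] at e1
    rw [e1, hF1] at e2
    linarith
  rcases eq_or_ne (l 1) 1 with hy | hy
  · rw [hy, powSlope_one]
    have hl' : ∀ s, l s = 1 := fun s => by rw [hl s, hy]; ring
    have := eq_mul_of_additive_of_nonneg (a := F) (fun x y => by rw [h, hl']; ring) hF x
    rwa [hF1, mul_one] at this
  · have hm : ∀ x y, l (x + y) = l x * l y := by
      intro x y
      rw [hl (x + y), h, hl x, hl y]; ring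
    have := eq_rpow_of_multiplicative hm h0 h1 (by rw [hl, hF0]; ring) x
    rw [powSlope_of_ne hy, ← this, hl x, eq_div_iff (sub_ne_zero.2 hy.symm)]
    ring

/-! ### Extreme points as products -/

theorem extremePoints_bernsteinBase {n : ℕ} {f : (Fin n → ℝ≥0) → ℝ}
    (hf : f ∈ (bernsteinBase n).extremePoints ℝ) :
    ∃ y : Fin n → unitInterval, ∀ t, f t = ∏ i, powSlope (y i) (t i) := by
  have hfC := hf.1.1
  have hf1 : f 1 = 1 := hf.1.2
  set l : Fin n → ℝ≥0 → ℝ := fun i s => shiftOp i s f 1 with hl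
  have h0 : ∀ i s, 0 ≤ l i s := fun i s => bernsteinCone_nonneg (shiftOp_mem hfC i s) 1
  have h1 : ∀ i s, l i s ≤ 1 := fun i s => by
    have := bernsteinCone_nonneg (sub_shiftOp_mem hfC i s) 1
    rw [Pi.sub_apply, hf1] at this
    linarith
  have key : ∀ i t x s, f (Function.update t i (x + s)) =
      f (Function.update t i s) + l i s * f (Function.update t i x) := by
    intro i t x s
    have := congrFun (shiftOp_eq_smul_of_mem_extremePoints hf i s) (Function.update t i x)
    rw [Pi.smul_apply, smul_eq_mul, shiftOp, update_add_single, Function.update_idem] at this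
    linarith
  have e1 : ∀ i : Fin n, Function.update (1 : Fin n → ℝ≥0) i 1 = 1 := fun i =>
    Function.update_eq_self i 1
  have hF : ∀ i x, f (Function.update 1 i x) = powSlope (l i 1) x := fun i =>
    eq_powSlope_of_shift (F := fun x => f (Function.update 1 i x))
      (fun x => bernsteinCone_nonneg hfC _) (by simp only [e1, hf1])
      (hfC.1 _ ⟨i, by simp⟩) (key i 1) (h0 i) (h1 i)
  -- The eigenvalue `l i s` is the same on every line in direction `i`, so the two-order expansion
  -- again applies and the profile on each line is a multiple of one `powSlope`.
  have hcoord : ∀ i t x, f (Function.update t i x) =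
      powSlope (l i 1) x * f (Function.update t i 1) := by
    intro i t x
    have hls : l i x = 1 - (1 - l i 1) * powSlope (l i 1) x := by
      have a1 := key i 1 1 x
      have a2 := key i 1 x 1
      rw [add_comm] at a1
      rw [a1, e1, hf1, hF] at a2
      linarith
    rcases eq_or_ne (l i 1) 1 with hy | hy
    · have hls' : ∀ s, l i s = 1 := by
        intro s
        have a1 := key i 1 1 s
        have a2 := key i 1 s 1
        rw [add_comm] at a1
        rw [a1, e1, hf1, hy] at a2
        linarith
      rw [hy, powSlope_one]
      exact eq_mul_of_additive_of_nonneg (a := fun x => f (Function.update t i x))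
        (fun x s => by simp only [key i t x s, hls']; ring) (fun x => bernsteinCone_nonneg hfC _) x
    · have a1 := key i t 1 x
      have a2 := key i t x 1
      rw [add_comm, a2, hls] at a1
      have : (1 - l i 1) * (f (Function.update t i x) -
          powSlope (l i 1) x * f (Function.update t i 1)) = 0 := by linarith
      rcases mul_eq_zero.1 this with h | h
      · exact absurd (by linarith) hy
      · linarith
  refine ⟨fun i => ⟨l i 1, h0 i 1, h1 i 1⟩, fun t => ?_⟩
  have hS : ∀ S : Finset (Fin n),
      f t = (∏ i ∈ S, powSlope (l i 1) (t i)) * f (S.piecewise 1 t) := by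
    intro S
    induction S using Finset.induction_on with
    | empty => simp
    | insert j S hj ih =>
      have := hcoord j (S.piecewise 1 t) (t j)
      rw [show Function.update (S.piecewise 1 t) j (t j) = S.piecewise 1 t by
        rw [Function.update_eq_iff]; simp [hj]] at this
      rw [ih, this, Finset.prod_insert hj, Finset.piecewise_insert]
      simp only [Pi.one_apply]
      ring
  have := hS Finset.univ
  rwa [Finset.piecewise_univ, hf1, mul_one] at this

/-! ### Krein–Milman: mixtures over the unit cube -/

/-- The mixture of the normalized product functions with respect to a probability measure. -/
noncomputable def mixture {n : ℕ} (μ : ProbabilityMeasure (Fin n → unitInterval)) :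
    (Fin n → ℝ≥0) → ℝ :=
  fun t => ∫ y, ∏ i, powSlope (y i) (t i) ∂(μ : Measure (Fin n → unitInterval))

theorem continuous_prod_powSlope {n : ℕ} (t : Fin n → ℝ≥0) :
    Continuous fun y : Fin n → unitInterval => ∏ i, powSlope (y i) (t i) :=
  continuous_finsetProd _ fun i _ => (continuous_powSlope (t i).2).comp
    (continuous_subtype_val.comp (continuous_apply i))

theorem integrable_prod_powSlope {n : ℕ} (μ : Measure (Fin n → unitInterval)) [IsFiniteMeasure μ]
    (t : Fin n → ℝ≥0) : Integrable (fun y => ∏ i, powSlope (y i) (t i)) μ :=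
  (BoundedContinuousFunction.mkOfCompact ⟨_, continuous_prod_powSlope t⟩).integrable μ

/-- The integrand is continuous on the compact cube, so weak convergence of measures passes to the
mixtures; hence the set of mixtures is compact. -/
theorem continuous_mixture {n : ℕ} : Continuous (mixture (n := n)) := by
  refine continuous_pi fun t => ?_
  exact ProbabilityMeasure.continuous_integral_boundedContinuousFunction
    (BoundedContinuousFunction.mkOfCompact ⟨_, continuous_prod_powSlope t⟩)

theorem convex_range_mixture {n : ℕ} : Convex ℝ (Set.range (mixture (n := n))) := by
  rintro _ ⟨μ, rfl⟩ _ ⟨ν, rfl⟩ a b ha hb hab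
  let m : Measure (Fin n → unitInterval) :=
    ENNReal.ofReal a • (μ : Measure _) + ENNReal.ofReal b • (ν : Measure _)
  have hm : IsProbabilityMeasure m := ⟨by
    simp [m, ← ENNReal.ofReal_add ha hb, hab]⟩
  refine ⟨⟨m, hm⟩, ?_⟩
  ext t
  have i1 := (integrable_prod_powSlope (μ : Measure _) t).smul_measure
    (c := ENNReal.ofReal a) ENNReal.ofReal_ne_top
  have i2 := (integrable_prod_powSlope (ν : Measure _) t).smul_measure
    (c := ENNReal.ofReal b) ENNReal.ofReal_ne_top
  simp only [mixture, ProbabilityMeasure.coe_mk, m, Pi.add_apply, Pi.smul_apply]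
  rw [integral_add_measure i1 i2, integral_smul_measure, integral_smul_measure,
    ENNReal.toReal_ofReal ha, ENNReal.toReal_ofReal hb]

/-- The base is the closed convex hull of its extreme points; these are mixtures by Dirac measures,
and the set of mixtures is convex and closed. -/
theorem bernsteinBase_subset_range_mixture {n : ℕ} :
    bernsteinBase n ⊆ Set.range (mixture (n := n)) := by
  rw [← closure_convexHull_extremePoints isCompact_bernsteinBase convex_bernsteinBase]
  refine closure_minimal (convexHull_min ?_ convex_range_mixture)
    (isCompact_range continuous_mixture).isClosed
  intro f hf
  obtain ⟨y, hy⟩ := extremePoints_bernsteinBase hf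
  refine ⟨⟨Measure.dirac y, inferInstance⟩, ?_⟩
  ext t
  rw [hy]
  exact integral_dirac _ _

/-! ### From the cube to the orthant -/

theorem bernsteinKernel_of_ne {r : ℝ} (hr : r ≠ 0) (t : ℝ) :
    bernsteinKernel r t = (1 - Real.exp (-(r * t))) * ((1 + r) / r) := if_neg hr

theorem bernsteinKernel_zero (t : ℝ) : bernsteinKernel 0 t = t := if_pos rfl

theorem measurable_bernsteinKernel (t : ℝ) : Measurable fun r => bernsteinKernel r t := by
  unfold bernsteinKernel
  refine Measurable.ite (measurableSet_singleton 0) measurable_const ?_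
  fun_prop

/-- Follows from `exp (-r) ≤ 1 / (1 + r)`. It allows division by the kernel at `1` without losing
finiteness of the measure. -/
theorem one_le_bernsteinKernel_one {r : ℝ} (hr : 0 ≤ r) : 1 ≤ bernsteinKernel r 1 := by
  rcases hr.eq_or_lt with rfl | h
  · rw [bernsteinKernel_zero]
  · rw [bernsteinKernel_of_ne h.ne', mul_one, Real.exp_neg, ← mul_div_assoc, le_div_iff₀ h]
    have h1 := Real.add_one_le_exp r
    have h2 : (Real.exp r)⁻¹ ≤ (1 + r)⁻¹ := inv_anti₀ (by linarith) (by linarith)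
    have h3 : (1 + r)⁻¹ * (1 + r) = 1 := inv_mul_cancel₀ (by linarith)
    nlinarith

theorem bernsteinKernel_neg_log {y : ℝ} (hy : 0 < y) (t : ℝ) :
    bernsteinKernel (-Real.log y) t = bernsteinKernel (-Real.log y) 1 * powSlope y t := by
  rcases eq_or_ne y 1 with rfl | h
  · simp [bernsteinKernel_zero, powSlope_one]
  · have hl : -Real.log y ≠ 0 := neg_ne_zero.2 (Real.log_ne_zero_of_pos_of_ne_one hy h)
    rw [bernsteinKernel_of_ne hl, bernsteinKernel_of_ne hl, powSlope_of_ne h, mul_one, neg_neg,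
      Real.exp_log hy, neg_mul, neg_neg, ← Real.rpow_def_of_pos hy]
    have : (1 - y) ≠ 0 := sub_ne_zero.2 h.symm
    field_simp

/-- A representing probability measure of a continuous function in the base does not charge the
coordinate hyperplanes. -/
theorem measure_zero_of_mixture {n : ℕ} (μ : ProbabilityMeasure (Fin n → unitInterval))
    (hc : Continuous (mixture μ)) (h0 : ∀ t, (∃ i, t i = 0) → mixture μ t = 0) (i : Fin n) :
    (μ : Measure (Fin n → unitInterval)) {y | y i = 0} = 0 := by
  let m := (μ : Measure (Fin n → unitInterval))
  -- At the point with `i`-th coordinate `x` and all others `1`, the integrand is `1` where `y i =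
  -- 0` and nonnegative elsewhere. Letting `x → 0` gives the claim.
  have hle : ∀ x : ℝ≥0, x ≠ 0 → m.real {y | y i = 0} ≤ mixture μ (Function.update 1 i x) := by
    intro x hx
    have hms : MeasurableSet {y : Fin n → unitInterval | y i = 0} :=
      (measurableSet_singleton (0 : unitInterval)).preimage (measurable_pi_apply i)
    rw [← integral_indicator_one hms]
    refine integral_mono ((integrable_const (1 : ℝ)).indicator hms) (integrable_prod_powSlope _ _)
      fun y => ?_
    dsimp only
    by_cases hy : y i = 0
    · rw [Set.indicator_of_mem (by exact hy)]
      refine le_of_eq (Finset.prod_eq_one fun j _ => ?_).symm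
      by_cases hj : j = i
      · subst hj
        rw [hy, Function.update_self]
        exact powSlope_zero (by exact_mod_cast hx)
      · simp [hj, powSlope_right_one]
    · rw [Set.indicator_of_notMem (by exact hy)]
      exact Finset.prod_nonneg fun j _ => powSlope_nonneg (y j).2.1 (y j).2.2 (NNReal.coe_nonneg _)
  have hlim : Filter.Tendsto (fun k : ℕ => mixture μ (Function.update 1 i (1 / ((k : ℝ≥0) + 1))))
      Filter.atTop (nhds 0) := by
    rw [← h0 (Function.update 1 i 0) ⟨i, by simp⟩]
    refine (hc.tendsto _).comp ?_
    exact tendsto_const_nhds.update i tendsto_one_div_add_atTop_nhds_zero_nat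
  have := ge_of_tendsto hlim (Filter.Eventually.of_forall fun k =>
    hle _ (by positivity))
  exact (measureReal_eq_zero_iff).1 (le_antisymm this measureReal_nonneg)

theorem exists_measure_of_mixture {n : ℕ} (μ : ProbabilityMeasure (Fin n → unitInterval))
    (hc : Continuous (mixture μ)) (h0 : ∀ t, (∃ i, t i = 0) → mixture μ t = 0) :
    ∃ η : Measure (Fin n → ℝ≥0), IsFiniteMeasure η ∧ ∀ t : Fin n → ℝ≥0,
      Integrable (fun r : Fin n → ℝ≥0 => ∏ i, bernsteinKernel (r i) (t i)) η ∧
        mixture μ t = ∫ r : Fin n → ℝ≥0, ∏ i, bernsteinKernel (r i) (t i) ∂η := by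
  let m := (μ : Measure (Fin n → unitInterval))
  let ψ : (Fin n → unitInterval) → Fin n → ℝ≥0 := fun y i => Real.toNNReal (-Real.log (y i))
  have hψ : Measurable ψ := by
    refine measurable_pi_lambda _ fun i => Measurable.real_toNNReal (Measurable.neg ?_)
    exact Real.measurable_log.comp (measurable_subtype_coe.comp (measurable_pi_apply i))
  let D : (Fin n → unitInterval) → ℝ≥0 := fun y =>
    Real.toNNReal (∏ i, (bernsteinKernel (ψ y i) 1)⁻¹)
  have hw : ∀ y i, 1 ≤ bernsteinKernel (ψ y i) 1 := fun y i =>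
    one_le_bernsteinKernel_one (NNReal.coe_nonneg _)
  have hD : Measurable D := by
    refine Measurable.real_toNNReal (Finset.measurable_prod _ fun i _ => Measurable.inv ?_)
    exact (measurable_bernsteinKernel 1).comp (measurable_coe_nnreal_real.comp
      ((measurable_pi_apply i).comp hψ))
  have hD1 : ∀ y, D y ≤ 1 := fun y => by
    rw [Real.toNNReal_le_one]
    exact Finset.prod_le_one (fun i _ => inv_nonneg.2 (zero_le_one.trans (hw y i)))
      fun i _ => inv_le_one_of_one_le₀ (hw y i)
  let η₀ := m.withDensity fun y => (D y : ENNReal)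
  have hfin : IsFiniteMeasure η₀ := by
    refine isFiniteMeasure_withDensity (ne_of_lt ?_)
    calc ∫⁻ y, (D y : ENNReal) ∂m ≤ ∫⁻ _, 1 ∂m :=
          lintegral_mono fun y => ENNReal.coe_le_one_iff.2 (hD1 y)
      _ < ⊤ := by simp
  -- Since `Real.log 0 = 0`, `ψ` sends `y i = 0` to the wrong rate `0`; these points form a null
  -- set.
  have hpos : ∀ᵐ y ∂m, ∀ i, y i ≠ 0 := by
    rw [ae_all_iff]
    intro i
    rw [ae_iff]
    simpa using measure_zero_of_mixture μ hc h0 i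
  have hker : ∀ t : Fin n → ℝ≥0, (fun y => ∏ i, powSlope (y i) (t i)) =ᵐ[m]
      fun y => D y • ∏ i, bernsteinKernel (ψ y i) (t i) := by
    intro t
    filter_upwards [hpos] with y hy
    rw [NNReal.smul_def, Real.coe_toNNReal _
      (Finset.prod_nonneg fun i _ => inv_nonneg.2 (zero_le_one.trans (hw y i))), smul_eq_mul,
      ← Finset.prod_mul_distrib]
    refine Finset.prod_congr rfl fun i _ => ?_
    have hyi : (0 : ℝ) < y i := lt_of_le_of_ne (y i).2.1
      fun h => hy i (Subtype.ext h.symm)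
    have hr : ((ψ y i : ℝ≥0) : ℝ) = -Real.log (y i) :=
      Real.coe_toNNReal _ (neg_nonneg.2 (Real.log_nonpos (y i).2.1 (y i).2.2))
    have h1 := hw y i
    rw [hr] at h1 ⊢
    rw [bernsteinKernel_neg_log hyi (t i), inv_mul_cancel_left₀ (by linarith)]
  have hKm : ∀ t : Fin n → ℝ≥0, Measurable
      fun r : Fin n → ℝ≥0 => ∏ i, bernsteinKernel (r i) (t i) := fun t =>
    Finset.measurable_prod _ fun i _ => (measurable_bernsteinKernel (t i)).comp
      (measurable_coe_nnreal_real.comp (measurable_pi_apply i))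
  refine ⟨η₀.map ψ, Measure.isFiniteMeasure_map η₀ ψ, fun t => ⟨?_, ?_⟩⟩
  · rw [integrable_map_measure (hKm t).aestronglyMeasurable hψ.aemeasurable]
    rw [integrable_withDensity_iff_integrable_smul hD]
    exact (integrable_prod_powSlope m t).congr (hker t)
  · rw [integral_map hψ.aemeasurable (hKm t).aestronglyMeasurable,
      integral_withDensity_eq_integral_smul hD]
    exact integral_congr_ae (hker t)

theorem exists_measure_of_mem_bernsteinCone {n : ℕ} {f : (Fin n → ℝ≥0) → ℝ}
    (hf : f ∈ bernsteinCone n) (hc : Continuous f) :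
    ∃ η : Measure (Fin n → ℝ≥0), IsFiniteMeasure η ∧ ∀ t : Fin n → ℝ≥0,
      Integrable (fun r : Fin n → ℝ≥0 => ∏ i, bernsteinKernel (r i) (t i)) η ∧
        f t = ∫ r : Fin n → ℝ≥0, ∏ i, bernsteinKernel (r i) (t i) ∂η := by
  rcases (bernsteinCone_nonneg hf 1).eq_or_lt with h | h
  · refine ⟨0, inferInstance, fun t => ⟨integrable_zero_measure, ?_⟩⟩
    simp [eq_zero_of_mem_bernsteinCone hf h.symm]
  · have hm : (f 1)⁻¹ • f ∈ bernsteinBase n :=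
      ⟨smul_mem_bernsteinCone hf (by positivity), by simp [h.ne']⟩
    obtain ⟨μ, hμ⟩ := bernsteinBase_subset_range_mixture hm
    obtain ⟨η, hη, hrep⟩ := exists_measure_of_mixture μ
      (by rw [hμ]; exact hc.const_smul _) (by rw [hμ]; exact hm.1.1)
    refine ⟨ENNReal.ofReal (f 1) • η, ?_, fun t => ⟨?_, ?_⟩⟩
    · exact Measure.smul_finite η ENNReal.ofReal_ne_top
    · exact (hrep t).1.smul_measure ENNReal.ofReal_ne_top
    · rw [integral_smul_measure, ENNReal.toReal_ofReal h.le, ← (hrep t).2, hμ]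
      simp [h.ne']

/-! ### From signs of derivatives to signs of differences -/

section derivatives
variable {n : ℕ}

theorem isOpen_openOrthant : IsOpen (openOrthant n) := by
  simp only [openOrthant, Set.ofPred_forall]
  exact isOpen_iInter_of_finite fun i => isOpen_lt continuous_const (continuous_apply i)

theorem update_mem_openOrthant {t : Fin n → ℝ} (ht : t ∈ openOrthant n) (i : Fin n) {x : ℝ}
    (hx : 0 < x) : Function.update t i x ∈ openOrthant n := by
  intro j
  by_cases h : j = i
  · subst h; simpa using hx
  · simpa [h] using ht j

theorem partialDeriv_congr {f f' : (Fin n → ℝ) → ℝ} (h : Set.EqOn f f' (openOrthant n))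
    (i : Fin n) : Set.EqOn (partialDeriv i f) (partialDeriv i f') (openOrthant n) := by
  intro t ht
  refine Filter.EventuallyEq.deriv_eq ?_
  filter_upwards [lt_mem_nhds (ht i)] with x hx
  exact h (update_mem_openOrthant ht i hx)

theorem iterate_partialDeriv_congr {f f' : (Fin n → ℝ) → ℝ} (h : Set.EqOn f f' (openOrthant n))
    (i : Fin n) (k : ℕ) :
    Set.EqOn ((partialDeriv i)^[k] f) ((partialDeriv i)^[k] f') (openOrthant n) := by
  induction k with
  | zero => exact h
  | succ k ih =>
    rw [Function.iterate_succ_apply', Function.iterate_succ_apply']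
    exact partialDeriv_congr ih i

theorem HasFDerivAt.hasDerivAt_update {f : (Fin n → ℝ) → ℝ} {f' : (Fin n → ℝ) →L[ℝ] ℝ}
    {t : Fin n → ℝ} (hf : HasFDerivAt f f' t) (i : Fin n) :
    HasDerivAt (fun s => f (Function.update t i s)) (f' (Pi.single i 1)) (t i) := by
  refine HasFDerivAt.comp_hasDerivAt (t i) ?_ (_root_.hasDerivAt_update t i (t i))
  rwa [Function.update_eq_self]

theorem ContDiffOn.differentiableAt_openOrthant {f : (Fin n → ℝ) → ℝ}
    (hf : ContDiffOn ℝ ∞ f (openOrthant n)) {t : Fin n → ℝ} (ht : t ∈ openOrthant n) :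
    DifferentiableAt ℝ f t :=
  (hf.contDiffAt (isOpen_openOrthant.mem_nhds ht)).differentiableAt (by simp)

theorem hasDerivAt_partialDeriv {f : (Fin n → ℝ) → ℝ} (hf : ContDiffOn ℝ ∞ f (openOrthant n))
    {t : Fin n → ℝ} (ht : t ∈ openOrthant n) (i : Fin n) :
    HasDerivAt (fun s => f (Function.update t i s)) (partialDeriv i f t) (t i) :=
  ((hf.differentiableAt_openOrthant ht).hasFDerivAt.hasDerivAt_update
    i).differentiableAt.hasDerivAt

theorem partialDeriv_eqOn_fderiv {f : (Fin n → ℝ) → ℝ} (hf : ContDiffOn ℝ ∞ f (openOrthant n))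
    (i : Fin n) : Set.EqOn (partialDeriv i f) (fun t => fderiv ℝ f t (Pi.single i 1))
      (openOrthant n) := fun _ ht =>
  ((hf.differentiableAt_openOrthant ht).hasFDerivAt.hasDerivAt_update i).deriv

theorem contDiffOn_partialDeriv {f : (Fin n → ℝ) → ℝ} (hf : ContDiffOn ℝ ∞ f (openOrthant n))
    (i : Fin n) : ContDiffOn ℝ ∞ (partialDeriv i f) (openOrthant n) :=
  (((contDiffOn_infty_iff_fderiv_of_isOpen isOpen_openOrthant).1 hf).2.clm_apply
    contDiffOn_const).congr (partialDeriv_eqOn_fderiv hf i)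

theorem contDiffOn_iterate_partialDeriv {f : (Fin n → ℝ) → ℝ}
    (hf : ContDiffOn ℝ ∞ f (openOrthant n)) (i : Fin n) (k : ℕ) :
    ContDiffOn ℝ ∞ ((partialDeriv i)^[k] f) (openOrthant n) := by
  induction k with
  | zero => exact hf
  | succ k ih =>
    rw [Function.iterate_succ_apply']
    exact contDiffOn_partialDeriv ih i

theorem partialDeriv_comm {f : (Fin n → ℝ) → ℝ} (hf : ContDiffOn ℝ ∞ f (openOrthant n))
    (i j : Fin n) : Set.EqOn (partialDeriv i (partialDeriv j f))
      (partialDeriv j (partialDeriv i f)) (openOrthant n) := by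
  have key : ∀ i j : Fin n, ∀ t ∈ openOrthant n, partialDeriv i (partialDeriv j f) t =
      fderiv ℝ (fderiv ℝ f) t (Pi.single i 1) (Pi.single j 1) := by
    intro i j t ht
    rw [partialDeriv_congr (partialDeriv_eqOn_fderiv hf j) i ht]
    have hd : HasFDerivAt (fderiv ℝ f) (fderiv ℝ (fderiv ℝ f) t) t :=
      (((((contDiffOn_infty_iff_fderiv_of_isOpen isOpen_openOrthant).1 hf).2).contDiffAt
        (isOpen_openOrthant.mem_nhds ht)).differentiableAt (by simp)).hasFDerivAt
    have := (hd.clm_apply (hasFDerivAt_const (Pi.single j (1 : ℝ)) t)).hasDerivAt_update i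
    rw [partialDeriv, this.deriv]
    simp
  intro t ht
  rw [key i j t ht, key j i t ht]
  exact ((contDiffOn_infty.1 hf 2).contDiffAt
    (isOpen_openOrthant.mem_nhds ht)).isSymmSndFDerivAt (by simp) _ _

theorem partialDeriv_iterate_comm {f : (Fin n → ℝ) → ℝ} (hf : ContDiffOn ℝ ∞ f (openOrthant n))
    (i j : Fin n) (k : ℕ) : Set.EqOn (partialDeriv i ((partialDeriv j)^[k] f))
      ((partialDeriv j)^[k] (partialDeriv i f)) (openOrthant n) := by
  induction k with
  | zero => exact fun _ _ => rfl
  | succ k ih =>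
    rw [Function.iterate_succ_apply', Function.iterate_succ_apply']
    exact (partialDeriv_comm (contDiffOn_iterate_partialDeriv hf j k) i j).trans
      (partialDeriv_congr ih j)

/-- The iterated partial derivatives in the variables of a list. -/
noncomputable def listPartial (l : List (Fin n)) (α : Fin n → ℕ) (h : (Fin n → ℝ) → ℝ) : (Fin n → ℝ) → ℝ :=
  l.foldr (fun i f => (partialDeriv i)^[α i] f) h

theorem listPartial_cons (j : Fin n) (l : List (Fin n)) (α : Fin n → ℕ) (h : (Fin n → ℝ) → ℝ) :
    listPartial (j :: l) α h = (partialDeriv j)^[α j] (listPartial l α h) := rfl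

theorem mixedPartial_eq_listPartial (α : Fin n → ℕ) (h : (Fin n → ℝ) → ℝ) :
    mixedPartial α h = listPartial (List.finRange n) α h := rfl

theorem contDiffOn_listPartial {f : (Fin n → ℝ) → ℝ} (hf : ContDiffOn ℝ ∞ f (openOrthant n))
    (l : List (Fin n)) (α : Fin n → ℕ) : ContDiffOn ℝ ∞ (listPartial l α f) (openOrthant n) := by
  induction l with
  | nil => exact hf
  | cons j l ih => exact contDiffOn_iterate_partialDeriv ih j _

theorem listPartial_add_single_of_notMem {l : List (Fin n)} {i : Fin n} (hi : i ∉ l)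
    (α : Fin n → ℕ) (f : (Fin n → ℝ) → ℝ) :
    listPartial l (α + Pi.single i 1) f = listPartial l α f := by
  induction l with
  | nil => rfl
  | cons j l ih =>
    rw [List.mem_cons, not_or] at hi
    rw [listPartial_cons, listPartial_cons, ih hi.2]
    simp [Ne.symm hi.1]

/-- By symmetry of second derivatives, the new `∂_i` moves past the other variables to its own slot,
which is unique because the list has no repetition. -/
theorem partialDeriv_listPartial {f : (Fin n → ℝ) → ℝ} (hf : ContDiffOn ℝ ∞ f (openOrthant n))
    {l : List (Fin n)} (hl : l.Nodup) {i : Fin n} (hi : i ∈ l) (α : Fin n → ℕ) :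
    Set.EqOn (partialDeriv i (listPartial l α f)) (listPartial l (α + Pi.single i 1) f)
      (openOrthant n) := by
  induction l with
  | nil => simp at hi
  | cons j l ih =>
    rw [List.nodup_cons] at hl
    rw [listPartial_cons, listPartial_cons]
    by_cases h : i = j
    · subst h
      rw [listPartial_add_single_of_notMem hl.1, Pi.add_apply, Pi.single_eq_same,
        Function.iterate_succ_apply']
      exact fun _ _ => rfl
    · have hi' : i ∈ l := by simpa [h] using hi
      rw [Pi.add_apply, Pi.single_eq_of_ne (Ne.symm h), add_zero]
      exact (partialDeriv_iterate_comm (contDiffOn_listPartial hf l α) i j _).trans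
        (iterate_partialDeriv_congr (ih hl.2 hi') j _)

theorem partialDeriv_mixedPartial {f : (Fin n → ℝ) → ℝ} (hf : ContDiffOn ℝ ∞ f (openOrthant n))
    (i : Fin n) (α : Fin n → ℕ) :
    Set.EqOn (partialDeriv i (mixedPartial α f)) (mixedPartial (α + Pi.single i 1) f)
      (openOrthant n) :=
  partialDeriv_listPartial hf (List.nodup_finRange n) (List.mem_finRange i) α

theorem mixedPartial_zero (f : (Fin n → ℝ) → ℝ) : mixedPartial 0 f = f := by
  rw [mixedPartial_eq_listPartial]
  induction List.finRange n with
  | nil => rfl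
  | cons j l ih => rw [listPartial_cons, ih]; rfl

/-- In a family that is closed under partial derivatives, mixed partial derivatives add up. -/
theorem mixedPartial_family {F : (Fin n → ℕ) → (Fin n → ℝ) → ℝ}
    (hF : ∀ α i, Set.EqOn (partialDeriv i (F α)) (F (α + Pi.single i 1)) (openOrthant n))
    (α β : Fin n → ℕ) : Set.EqOn (mixedPartial α (F β)) (F (β + α)) (openOrthant n) := by
  have hit : ∀ (i : Fin n) (k : ℕ) γ f, Set.EqOn f (F γ) (openOrthant n) →
      Set.EqOn ((partialDeriv i)^[k] f) (F (γ + Pi.single i k)) (openOrthant n) := by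
    intro i k γ f hf
    induction k with
    | zero => simpa using hf
    | succ k ih =>
      rw [Function.iterate_succ_apply', Pi.single_add, ← add_assoc]
      exact (partialDeriv_congr ih i).trans (hF _ i)
  have hl : ∀ l : List (Fin n), Set.EqOn (listPartial l α (F β))
      (F (β + (l.map fun i => Pi.single i (α i)).sum)) (openOrthant n) := by
    intro l
    induction l with
    | nil => simpa using! Set.eqOn_refl (F β) (openOrthant n)
    | cons j l ih =>
      rw [listPartial_cons, List.map_cons, List.sum_cons, add_left_comm, add_comm]
      exact hit _ _ _ _ ih
  have := hl (List.finRange n)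
  rwa [← Fin.sum_univ_def, Finset.univ_sum_single] at this

/-- The derivatives of a function that becomes completely monotone after the derivative `β`. -/
structure IsAlternatingFamily (β : Fin n → ℕ) (F : (Fin n → ℕ) → (Fin n → ℝ) → ℝ) : Prop where
  hasDerivAt : ∀ α i, ∀ t ∈ openOrthant n,
    HasDerivAt (fun s => F α (Function.update t i s)) (F (α + Pi.single i 1) t) (t i)
  sign : ∀ α, ∀ t ∈ openOrthant n, 0 ≤ (-1 : ℝ) ^ (∑ i, α i) * F (β + α) t

/-- The inclusion of the closed orthant. -/
def orthantIncl (n : ℕ) : (Fin n → ℝ≥0) →+ (Fin n → ℝ) where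
  toFun t i := t i
  map_zero' := by ext; simp
  map_add' s t := by ext; simp

theorem orthantIncl_single (i : Fin n) (s : ℝ≥0) :
    orthantIncl n (Pi.single i s) = Pi.single i (s : ℝ) := by
  ext j
  by_cases h : j = i
  · subst h; simp [orthantIncl]
  · simp [orthantIncl, h]

theorem add_orthantIncl_mem {t : Fin n → ℝ} (ht : t ∈ openOrthant n) (a : Fin n → ℝ≥0) :
    t + orthantIncl n a ∈ openOrthant n := fun i =>
  add_pos_of_pos_of_nonneg (ht i) (a i).2

theorem le_add_single_of_deriv_nonneg {f f' : (Fin n → ℝ) → ℝ} (i : Fin n)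
    (hf : ∀ t ∈ openOrthant n, HasDerivAt (fun s => f (Function.update t i s)) (f' t) (t i))
    (hf' : ∀ t ∈ openOrthant n, 0 ≤ f' t) {t : Fin n → ℝ} (ht : t ∈ openOrthant n) (s : ℝ≥0) :
    f t ≤ f (t + orthantIncl n (Pi.single i s)) := by
  have hd : ∀ x ∈ Set.Ici (t i), HasDerivAt (fun s => f (Function.update t i s))
      (f' (Function.update t i x)) x := by
    intro x hx
    have := hf _ (update_mem_openOrthant ht i ((ht i).trans_le hx))
    simpa using this
  have hm : MonotoneOn (fun s => f (Function.update t i s)) (Set.Ici (t i)) := by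
    refine monotoneOn_of_deriv_nonneg (convex_Ici _)
      (fun x hx => (hd x hx).continuousAt.continuousWithinAt) ?_ ?_
    · exact fun x hx => (hd x (interior_subset hx)).differentiableAt.differentiableWithinAt
    · intro x hx
      rw [(hd x (interior_subset hx)).deriv]
      exact hf' _ (update_mem_openOrthant ht i ((ht i).trans_le (interior_subset hx)))
  have := hm (Set.mem_Ici.2 le_rfl) (Set.mem_Ici.2 (le_add_of_nonneg_right s.2))
    (le_add_of_nonneg_right s.2)
  dsimp only at this
  rw [Function.update_eq_self] at this
  have e : t + orthantIncl n (Pi.single i s) = Function.update t i (t i + s) := by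
    rw [orthantIncl_single]
    ext j
    by_cases h : j = i
    · subst h; simp
    · simp [h]
  rwa [e]

theorem hasDerivAt_translate {f f' : (Fin n → ℝ) → ℝ} (i : Fin n)
    (hf : ∀ t ∈ openOrthant n, HasDerivAt (fun s => f (Function.update t i s)) (f' t) (t i))
    {t : Fin n → ℝ} (ht : t ∈ openOrthant n) (a : Fin n → ℝ≥0) :
    HasDerivAt (fun s => f (Function.update t i s + orthantIncl n a))
      (f' (t + orthantIncl n a)) (t i) := by
  have h := hf _ (add_orthantIncl_mem ht a)
  rw [Pi.add_apply] at h
  have := HasDerivAt.comp_add_const (t i) (orthantIncl n a i) h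
  have e : ∀ x, Function.update t i x + orthantIncl n a =
      Function.update (t + orthantIncl n a) i (x + orthantIncl n a i) := by
    intro x
    ext j
    by_cases h : j = i
    · subst h; simp
    · simp [h]
  simpa only [e] using this

theorem translationAction_diffElt (i : Fin n) (s : ℝ≥0) (f : (Fin n → ℝ) → ℝ) :
    translationAction (orthantIncl n) (diffElt i s) f =
      fun t => f (t + orthantIncl n (Pi.single i s)) - f t := by
  ext t
  simp [diffElt, translationAction_single]

/-- One derivative in `β` is traded for one difference: the sign of `∂_i` of a function is the sign
of its increments in direction `i`. -/
theorem IsAlternatingFamily.diff {β : Fin n → ℕ} {F : (Fin n → ℕ) → (Fin n → ℝ) → ℝ} {i : Fin n}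
    (hF : IsAlternatingFamily (β + Pi.single i 1) F) (s : ℝ≥0) :
    IsAlternatingFamily β fun α => translationAction (orthantIncl n) (diffElt i s) (F α) := by
  simp only [translationAction_diffElt]
  refine ⟨fun α j t ht => ?_, fun α t ht => ?_⟩
  · exact (hasDerivAt_translate j (hF.hasDerivAt α j) ht _).sub (hF.hasDerivAt α j t ht)
  · have := le_add_single_of_deriv_nonneg (f := fun t => (-1 : ℝ) ^ (∑ i, α i) * F (β + α) t)
      (f' := fun t => (-1 : ℝ) ^ (∑ i, α i) * F (β + α + Pi.single i 1) t) i
      (fun t ht => (hF.hasDerivAt _ i t ht).const_mul _)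
      (fun t ht => by
        have := hF.sign α t ht
        rwa [add_right_comm] at this) ht s
    rw [mul_sub]
    linarith

/-- One more derivative reverses the sign, so the negated increment keeps it and `β` is unchanged.
-/
theorem IsAlternatingFamily.neg_diff {β : Fin n → ℕ} {F : (Fin n → ℕ) → (Fin n → ℝ) → ℝ}
    (hF : IsAlternatingFamily β F) (i : Fin n) (s : ℝ≥0) :
    IsAlternatingFamily β fun α => translationAction (orthantIncl n) (-diffElt i s) (F α) := by
  simp only [map_neg, LinearMap.neg_apply, translationAction_diffElt]
  refine ⟨fun α j t ht => ?_, fun α t ht => ?_⟩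
  · exact ((hasDerivAt_translate j (hF.hasDerivAt α j) ht _).sub (hF.hasDerivAt α j t ht)).neg
  · have := le_add_single_of_deriv_nonneg (f := fun t => -((-1 : ℝ) ^ (∑ i, α i) * F (β + α) t))
      (f' := fun t => -((-1 : ℝ) ^ (∑ i, α i) * F (β + α + Pi.single i 1) t)) i
      (fun t ht => ((hF.hasDerivAt _ i t ht).const_mul _).neg)
      (fun t ht => by
        have := hF.sign (α + Pi.single i 1) t ht
        rw [← add_assoc] at this
        simp only [Pi.add_apply, Finset.sum_add_distrib, Finset.sum_pi_single', Finset.mem_univ,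
          if_true, pow_succ] at this
        rw [mul_neg_one, neg_mul] at this
        exact this) ht s
    rw [Pi.neg_apply, mul_neg, mul_sub]
    linarith

theorem IsAlternatingFamily.act_nonneg {F : (Fin n → ℕ) → (Fin n → ℝ) → ℝ}
    (hF : IsAlternatingFamily 1 F) (u : Fin n → ℝ≥0) (l : List (Fin n × ℝ≥0)) {t : Fin n → ℝ}
    (ht : t ∈ openOrthant n) :
    0 ≤ translationAction (orthantIncl n) (altElt l * boxElt u) (F 0) t := by
  -- `S.piecewise 0 1` records the variables whose derivative has not yet been traded for a
  -- difference.
  have hbox : ∀ S : Finset (Fin n), IsAlternatingFamily (S.piecewise 0 1) fun α =>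
      translationAction (orthantIncl n) (∏ i ∈ S, diffElt i (u i)) (F α) := by
    intro S
    induction S using Finset.induction_on with
    | empty => simpa using hF
    | insert j S hj ih =>
      have hp : S.piecewise (0 : Fin n → ℕ) 1 =
          (insert j S).piecewise (0 : Fin n → ℕ) 1 + Pi.single j 1 := by
        ext i
        by_cases h : i = j
        · subst h; simp [hj]
        · by_cases hi : i ∈ S <;> simp [h, hi]
      rw [hp] at ih
      simpa [Finset.prod_insert hj] using ih.diff (u j)
  have hl : IsAlternatingFamily 0 fun α =>
      translationAction (orthantIncl n) (altElt l * boxElt u) (F α) := by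
    induction l with
    | nil => simpa [altElt, boxElt] using hbox Finset.univ
    | cons p l ih => simpa [altElt, mul_assoc] using ih.neg_diff p.1 p.2
  simpa using hl.sign 0 t ht

theorem isAlternatingFamily_mixedPartial {g : (Fin n → ℝ) → ℝ} (hg : IsBernsteinOfOrderN g) :
    IsAlternatingFamily 1 fun α => mixedPartial α g := by
  have hd := fun α i => partialDeriv_mixedPartial hg.1 i α
  refine ⟨fun α i t ht => ?_, fun α t ht => ?_⟩
  · rw [← hd α i ht]
    exact hasDerivAt_partialDeriv (contDiffOn_listPartial hg.1 _ α) ht i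
  · rw [← mixedPartial_family (F := fun α => mixedPartial α g) hd α 1 ht]
    exact hg.2.2 α t ht

theorem continuous_comp_orthantIncl {g : (Fin n → ℝ) → ℝ} (hg : ContinuousOn g (closedOrthant n)) :
    Continuous (g ∘ orthantIncl n) := by
  refine hg.comp_continuous ?_ fun t i => (t i).2
  exact continuous_pi fun i => NNReal.continuous_coe.comp (continuous_apply i)

/-- Derivatives control differences only based at interior points; continuity carries the
inequalities to the boundary. -/
theorem IsBernsteinOfOrderN.mem_bernsteinCone {g : (Fin n → ℝ) → ℝ}
    (hc : ContinuousOn g (closedOrthant n)) (hg0 : ∀ t ∈ orthantBoundary n, g t = 0)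
    (hg : IsBernsteinOfOrderN g) : g ∘ orthantIncl n ∈ bernsteinCone n := by
  refine ⟨fun t ⟨i, hi⟩ => hg0 _ ⟨fun j => (t j).2, i, by simp [orthantIncl, hi]⟩,
    fun u l t => ?_⟩
  have hcont : Continuous (act (altElt l * boxElt u) (g ∘ orthantIncl n)) :=
    continuous_translationAction _ _ (continuous_comp_orthantIncl hc)
  have hlim : Filter.Tendsto (fun k : ℕ => t + fun _ => 1 / ((k : ℝ≥0) + 1)) Filter.atTop
      (nhds t) := by
    have : Filter.Tendsto (fun k : ℕ => t + fun _ => 1 / ((k : ℝ≥0) + 1)) Filter.atTop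
      (nhds (t + fun _ => 0)) := tendsto_const_nhds.add
        (tendsto_pi_nhds.2 fun _ => tendsto_one_div_add_atTop_nhds_zero_nat)
    convert this using 2
    ext; simp
  refine ge_of_tendsto ((hcont.tendsto t).comp hlim) (Filter.Eventually.of_forall fun k => ?_)
  dsimp only [Function.comp_apply]
  rw [act, translationAction_comp]
  have := (isAlternatingFamily_mixedPartial hg).act_nonneg u l
    (t := orthantIncl n (t + fun _ => 1 / ((k : ℝ≥0) + 1))) fun i => by
      rw [orthantIncl]
      exact NNReal.coe_pos.2 (by simp only [Pi.add_apply]; positivity)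
  rwa [mixedPartial_zero] at this

end derivatives

/-! ### Derivatives of the kernel, bounded uniformly in the rate -/

/-- The derivatives of the kernel in its second variable. -/
noncomputable def kernelDeriv : ℕ → ℝ → ℝ → ℝ
  | 0, r, t => bernsteinKernel r t
  | m + 1, r, t => (1 + r) * (-r) ^ m * Real.exp (-(r * t))

theorem hasDerivAt_exp_neg_mul (r t : ℝ) :
    HasDerivAt (fun t => Real.exp (-(r * t))) (-r * Real.exp (-(r * t))) t := by
  have := ((hasDerivAt_id t).const_mul r).neg.exp
  simpa [mul_comm] using this

theorem hasDerivAt_kernelDeriv (m : ℕ) (r t : ℝ) :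
    HasDerivAt (kernelDeriv m r) (kernelDeriv (m + 1) r t) t := by
  cases m with
  | zero =>
    rcases eq_or_ne r 0 with rfl | hr
    · have : kernelDeriv 0 0 = id := by ext t; simp [kernelDeriv, bernsteinKernel_zero]
      rw [this]
      simpa [kernelDeriv] using hasDerivAt_id t
    · have : kernelDeriv 0 r = fun t => (1 - Real.exp (-(r * t))) * ((1 + r) / r) := by
        ext t; simp [kernelDeriv, bernsteinKernel_of_ne hr]
      rw [this]
      refine (((hasDerivAt_exp_neg_mul r t).const_sub 1).mul_const ((1 + r) / r)).congr_deriv ?_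
      simp only [kernelDeriv]
      field_simp
  | succ m =>
    refine ((hasDerivAt_exp_neg_mul r t).const_mul ((1 + r) * (-r) ^ m)).congr_deriv ?_
    simp only [kernelDeriv]
    ring

theorem measurable_kernelDeriv (m : ℕ) (t : ℝ) : Measurable fun r => kernelDeriv m r t := by
  cases m with
  | zero => exact measurable_bernsteinKernel t
  | succ m => unfold kernelDeriv; fun_prop

theorem exists_bound_kernelDeriv (m : ℕ) {a : ℝ} (ha : 0 < a) (b : ℝ) :
    ∃ C, 0 ≤ C ∧ ∀ r t : ℝ, 0 ≤ r → a ≤ t → t ≤ b → |kernelDeriv m r t| ≤ C := by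
  cases m with
  | zero =>
    -- The kernel is `(1 - e^{-rt}) / r + (1 - e^{-rt}) ≤ t + 1`.
    refine ⟨|b| + 1, by positivity, fun r t hr hat htb => ?_⟩
    have hb : b ≤ |b| := le_abs_self b
    rcases hr.eq_or_lt with rfl | h
    · rw [kernelDeriv, bernsteinKernel_zero, abs_of_pos (ha.trans_le hat)]
      linarith
    · have h1 : Real.exp (-(r * t)) ≤ 1 :=
        Real.exp_le_one_iff.2 (neg_nonpos.2 (mul_nonneg hr (ha.le.trans hat)))
      have h2 := Real.one_sub_le_exp_neg (r * t)
      have h3 := Real.exp_pos (-(r * t))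
      rw [kernelDeriv, bernsteinKernel_of_ne h.ne', abs_of_nonneg
        (mul_nonneg (by linarith) (by positivity)), ← mul_div_assoc, div_le_iff₀ h]
      nlinarith
  | succ m =>
    refine ⟨(m + 1).factorial / a ^ (m + 1) * Real.exp a, by positivity,
      fun r t hr hat htb => ?_⟩
    -- The exponential at `a * (1 + r)` dominates the polynomial factor `(1 + r) ^ (m + 1)`; the
    -- surplus `exp a` goes into the constant.
    have h1 := Real.pow_div_factorial_le_exp (a * (1 + r)) (by positivity) (m + 1)
    rw [div_le_iff₀ (by positivity), mul_pow] at h1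
    have h2 : Real.exp (-(r * t)) ≤ Real.exp (-(r * a)) := Real.exp_le_exp.2 (by nlinarith)
    have h3 : |kernelDeriv (m + 1) r t| ≤ (1 + r) ^ (m + 1) * Real.exp (-(r * a)) := by
      rw [kernelDeriv, abs_mul, abs_mul, abs_pow, abs_neg, abs_of_nonneg hr, Real.abs_exp,
        abs_of_nonneg (by linarith : 0 ≤ 1 + r), pow_succ']
      have : r ^ m ≤ (1 + r) ^ m := pow_le_pow_left₀ hr (by linarith) m
      gcongr
    refine h3.trans ?_
    rw [div_mul_eq_mul_div, le_div_iff₀ (by positivity)]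
    calc (1 + r) ^ (m + 1) * Real.exp (-(r * a)) * a ^ (m + 1)
        = a ^ (m + 1) * (1 + r) ^ (m + 1) * Real.exp (-(r * a)) := by ring
      _ ≤ Real.exp (a * (1 + r)) * (m + 1).factorial * Real.exp (-(r * a)) := by gcongr
      _ = (m + 1).factorial * Real.exp a := by
        rw [mul_right_comm, ← Real.exp_add, mul_comm]
        congr 2; ring

/-! ### Differentiation under the integral -/

section converse
variable {n : ℕ}

/-- The product kernel differentiated according to a multi-index. -/
noncomputable def productKernel (β : Fin n → ℕ) (r : Fin n → ℝ≥0) (t : Fin n → ℝ) : ℝ :=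
  ∏ i, kernelDeriv (β i) (r i) (t i)

theorem measurable_productKernel (β : Fin n → ℕ) (t : Fin n → ℝ) :
    Measurable fun r => productKernel β r t :=
  Finset.measurable_prod _ fun i _ => (measurable_kernelDeriv (β i) (t i)).comp
    (measurable_coe_nnreal_real.comp (measurable_pi_apply i))

theorem hasFDerivAt_productKernel (β : Fin n → ℕ) (r : Fin n → ℝ≥0) (t : Fin n → ℝ) :
    HasFDerivAt (productKernel β r) (∑ i, productKernel (β + Pi.single i 1) r t •
      (ContinuousLinearMap.proj i : (Fin n → ℝ) →L[ℝ] ℝ)) t := by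
  have hi : ∀ i ∈ Finset.univ, HasFDerivAt (fun t : Fin n → ℝ => kernelDeriv (β i) (r i) (t i))
      (kernelDeriv (β i + 1) (r i) (t i) •
        (ContinuousLinearMap.proj i : (Fin n → ℝ) →L[ℝ] ℝ)) t := fun i _ =>
    (hasDerivAt_kernelDeriv (β i) (r i) (t i)).comp_hasFDerivAt (f := fun t : Fin n → ℝ => t i) t
      (hasFDerivAt_apply i t)
  have h := HasFDerivAt.finsetProd hi
  refine h.congr_fderiv (Eq.symm ?_)
  refine Finset.sum_congr rfl fun i _ => ?_
  rw [smul_smul, productKernel, ← Finset.prod_erase_mul _ _ (Finset.mem_univ i)]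
  congr 2
  · refine Finset.prod_congr rfl fun j hj => ?_
    simp [Finset.ne_of_mem_erase hj]
  · simp

theorem exists_bound_productKernel (β : Fin n → ℕ) {t : Fin n → ℝ} (ht : t ∈ openOrthant n) :
    ∃ C, ∀ r, ∀ x ∈ Set.pi Set.univ fun i => Set.Ioo (t i / 2) (t i + 1),
      |productKernel β r x| ≤ C := by
  choose C hC0 hC using fun i => exists_bound_kernelDeriv (β i) (half_pos (ht i)) (t i + 1)
  refine ⟨∏ i, C i, fun r x hx => ?_⟩
  rw [productKernel, Finset.abs_prod]
  exact Finset.prod_le_prod (fun i _ => abs_nonneg _) fun i _ =>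
    hC i _ _ (r i).2 (hx i trivial).1.le (hx i trivial).2.le

variable (η : Measure (Fin n → ℝ≥0)) [IsFiniteMeasure η]

theorem box_mem_nhds {t : Fin n → ℝ} :
    (Set.pi Set.univ fun i => Set.Ioo (t i / 2) (t i + 1)) ∈ nhds t ↔ t ∈ openOrthant n := by
  rw [set_pi_mem_nhds_iff Set.finite_univ]
  simp only [Set.mem_univ, true_implies]
  refine forall_congr' fun i => ?_
  rw [IsOpen.mem_nhds_iff isOpen_Ioo, Set.mem_Ioo]
  constructor
  · intro h; linarith [h.1]
  · intro h; constructor <;> linarith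

theorem integrable_productKernel (β : Fin n → ℕ) {t : Fin n → ℝ} (ht : t ∈ openOrthant n) :
    Integrable (fun r => productKernel β r t) η := by
  obtain ⟨C, hC⟩ := exists_bound_productKernel β ht
  exact Integrable.of_bound (measurable_productKernel β t).aestronglyMeasurable C
    (Filter.Eventually.of_forall fun r => hC r t (mem_of_mem_nhds (box_mem_nhds.2 ht)))

/-- The mixture of the differentiated product kernels. -/
noncomputable def kernelIntegral (β : Fin n → ℕ) (t : Fin n → ℝ) : ℝ :=
  ∫ r, productKernel β r t ∂η

theorem hasFDerivAt_kernelIntegral (β : Fin n → ℕ) {t : Fin n → ℝ} (ht : t ∈ openOrthant n) :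
    HasFDerivAt (kernelIntegral η β) (∑ i, kernelIntegral η (β + Pi.single i 1) t •
      (ContinuousLinearMap.proj i : (Fin n → ℝ) →L[ℝ] ℝ)) t := by
  choose C hC using fun i : Fin n => exists_bound_productKernel (β + Pi.single i 1) ht
  have hm : AEStronglyMeasurable (fun r => ∑ i, productKernel (β + Pi.single i 1) r t •
      (ContinuousLinearMap.proj i : (Fin n → ℝ) →L[ℝ] ℝ)) η :=
    Finset.aestronglyMeasurable_fun_sum _ fun i _ =>
      ((measurable_productKernel _ t).aestronglyMeasurable).smul_const _
  have hb : ∀ r, ∀ x ∈ Set.pi Set.univ fun i => Set.Ioo (t i / 2) (t i + 1),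
      ‖∑ i, productKernel (β + Pi.single i 1) r x •
        (ContinuousLinearMap.proj i : (Fin n → ℝ) →L[ℝ] ℝ)‖ ≤
      ∑ i, C i * ‖(ContinuousLinearMap.proj i : (Fin n → ℝ) →L[ℝ] ℝ)‖ := by
    intro r x hx
    refine (norm_sum_le _ _).trans (Finset.sum_le_sum fun i _ => ?_)
    rw [norm_smul]
    exact mul_le_mul_of_nonneg_right (hC i r x hx) (norm_nonneg _)
  have h := hasFDerivAt_integral_of_dominated_of_fderiv_le (𝕜 := ℝ) (box_mem_nhds.2 ht)
    (Filter.Eventually.of_forall fun x => (measurable_productKernel β x).aestronglyMeasurable)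
    (integrable_productKernel η β ht) hm (Filter.Eventually.of_forall hb) (integrable_const _)
    (Filter.Eventually.of_forall fun r x _ => hasFDerivAt_productKernel β r x)
  rw [integral_finsetSum _ fun i _ => (integrable_productKernel η _ ht).smul_const _] at h
  simp only [integral_smul_const] at h
  exact h

theorem partialDeriv_kernelIntegral (β : Fin n → ℕ) (i : Fin n) :
    Set.EqOn (partialDeriv i (kernelIntegral η β)) (kernelIntegral η (β + Pi.single i 1))
      (openOrthant n) := by
  intro t ht
  rw [partialDeriv, ((hasFDerivAt_kernelIntegral η β ht).hasDerivAt_update i).deriv]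
  simp [Pi.single_apply]

/-- The coefficients of the Fréchet derivative are integrals of the same family, so the induction on
the order runs over all `β` at once. -/
theorem contDiffOn_kernelIntegral (β : Fin n → ℕ) :
    ContDiffOn ℝ ∞ (kernelIntegral η β) (openOrthant n) := by
  rw [contDiffOn_infty]
  intro m
  induction m generalizing β with
  | zero =>
    rw [Nat.cast_zero, contDiffOn_zero]
    exact fun t ht => (hasFDerivAt_kernelIntegral η β ht).continuousAt.continuousWithinAt
  | succ m ih =>
    rw [Nat.cast_succ, contDiffOn_succ_iff_fderiv_of_isOpen isOpen_openOrthant]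
    refine ⟨fun t ht => (hasFDerivAt_kernelIntegral η β ht).differentiableAt.differentiableWithinAt,
      by simp, ?_⟩
    refine ContDiffOn.congr (f := fun t => ∑ i, kernelIntegral η (β + Pi.single i 1) t •
      (ContinuousLinearMap.proj i : (Fin n → ℝ) →L[ℝ] ℝ)) ?_
      fun t ht => (hasFDerivAt_kernelIntegral η β ht).fderiv
    exact ContDiffOn.sum fun i _ => (ih _).smul contDiffOn_const

theorem listPartial_congr {f f' : (Fin n → ℝ) → ℝ} (h : Set.EqOn f f' (openOrthant n))
    (l : List (Fin n)) (α : Fin n → ℕ) :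
    Set.EqOn (listPartial l α f) (listPartial l α f') (openOrthant n) := by
  induction l with
  | nil => exact h
  | cons j l ih => exact iterate_partialDeriv_congr ih j _

/-- After `∂^{1+α}` each factor is `(1 + r_i) (-r_i)^{α_i} e^{-r_i t_i}`, whose sign is that of
`(-1)^{α_i}`. -/
theorem Represents.isBernsteinOfOrderN {g : (Fin n → ℝ) → ℝ} (h : Represents η g) :
    IsBernsteinOfOrderN g := by
  have hg : Set.EqOn g (kernelIntegral η 0) (openOrthant n) := fun t ht =>
    (h t fun i => (ht i).le).2
  have hI := fun α i => partialDeriv_kernelIntegral η α i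
  have h1 : Set.EqOn (mixedPartial (fun _ => 1) g) (kernelIntegral η 1) (openOrthant n) := by
    refine (listPartial_congr hg _ _).trans ?_
    have := mixedPartial_family hI 1 0
    rwa [zero_add] at this
  refine ⟨(contDiffOn_kernelIntegral η 0).congr hg, (contDiffOn_kernelIntegral η 1).congr h1,
    fun α t ht => ?_⟩
  have h2 : mixedPartial α (mixedPartial (fun _ => 1) g) t = kernelIntegral η (1 + α) t :=
    (listPartial_congr h1 _ α ht).trans (mixedPartial_family hI α 1 ht)
  rw [h2, kernelIntegral, ← integral_const_mul]
  refine integral_nonneg fun r => ?_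
  rw [Pi.zero_apply, productKernel, ← Finset.prod_pow_eq_pow_sum, ← Finset.prod_mul_distrib]
  refine Finset.prod_nonneg fun i _ => ?_
  rw [Pi.add_apply, Pi.one_apply, add_comm 1 (α i)]
  simp only [kernelDeriv]
  rw [neg_pow]
  have e : (-1 : ℝ) ^ α i * (-1) ^ α i = 1 := by rw [← mul_pow]; simp
  calc (0 : ℝ) ≤ (1 + r i) * (r i : ℝ) ^ α i * Real.exp (-(r i * t i)) := by positivity
    _ = ((-1 : ℝ) ^ α i * (-1) ^ α i) * ((1 + r i) * (r i : ℝ) ^ α i *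
        Real.exp (-(r i * t i))) := by rw [e, one_mul]
    _ = _ := by ring

end converse

/-! ### Uniqueness by the Laplace transform -/

section uniqueness
variable {n : ℕ}

theorem act_integral {Ω : Type*} [MeasurableSpace Ω] (μ : Measure Ω)
    {K : Ω → (Fin n → ℝ≥0) → ℝ} (hK : ∀ t, Integrable (fun w => K w t) μ)
    (P : AddMonoidAlgebra ℝ (Fin n → ℝ≥0)) (t : Fin n → ℝ≥0) :
    Integrable (fun w => act P (K w) t) μ ∧
      act P (fun t => ∫ w, K w t ∂μ) t = ∫ w, act P (K w) t ∂μ := by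
  induction P using AddMonoidAlgebra.induction_linear with
  | zero => simp [act]
  | add P Q hP hQ =>
    simp only [act, map_add, LinearMap.add_apply, Pi.add_apply] at hP hQ ⊢
    exact ⟨hP.1.add hQ.1, by rw [integral_add hP.1 hQ.1, hP.2, hQ.2]⟩
  | single a c =>
    simp only [act, translationAction_single]
    exact ⟨(hK _).const_mul c, (integral_const_mul _ _).symm⟩

theorem act_boxElt_prod (k : Fin n → ℝ≥0 → ℝ) (u t : Fin n → ℝ≥0) :
    act (boxElt u) (fun t => ∏ i, k i (t i)) t = ∏ i, (k i (t i + u i) - k i (t i)) := by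
  have hS : ∀ (S : Finset (Fin n)) (t : Fin n → ℝ≥0),
      act (∏ i ∈ S, diffElt i (u i)) (fun t => ∏ i, k i (t i)) t =
        (∏ i ∈ S, (k i (t i + u i) - k i (t i))) * ∏ i ∈ Sᶜ, k i (t i) := by
    intro S
    induction S using Finset.induction_on with
    | empty => intro t; simp [act]
    | insert j S hj ih =>
      intro t
      have hjc : j ∈ Sᶜ := Finset.mem_compl.2 hj
      rw [Finset.prod_insert hj, act_mul, act_diffElt, ih, ih, Finset.prod_insert hj,
        Finset.compl_insert, ← Finset.mul_prod_erase _ _ hjc, ← Finset.mul_prod_erase _ _ hjc]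
      have e1 : ∏ i ∈ S, (k i ((t + Pi.single j (u j) : Fin n → ℝ≥0) i + u i) -
          k i ((t + Pi.single j (u j) : Fin n → ℝ≥0) i)) =
          ∏ i ∈ S, (k i (t i + u i) - k i (t i)) := by
        refine Finset.prod_congr rfl fun i hi => ?_
        have : i ≠ j := fun h => hj (h ▸ hi)
        simp [this]
      have e2 : ∏ i ∈ Sᶜ.erase j, k i ((t + Pi.single j (u j) : Fin n → ℝ≥0) i) =
          ∏ i ∈ Sᶜ.erase j, k i (t i) := by
        refine Finset.prod_congr rfl fun i hi => ?_
        simp [Finset.ne_of_mem_erase hi]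
      rw [e1, e2, Pi.add_apply, Pi.single_eq_same]
      ring
  simpa [boxElt] using hS Finset.univ t

/-- A unit difference turns the kernel into a pure exponential times a weight free of `t`. -/
theorem bernsteinKernel_add_one_sub (r t : ℝ) :
    bernsteinKernel r (t + 1) - bernsteinKernel r t =
      Real.exp (-(r * t)) * bernsteinKernel r 1 := by
  rcases eq_or_ne r 0 with rfl | hr
  · simp [bernsteinKernel_zero]
  · rw [bernsteinKernel_of_ne hr, bernsteinKernel_of_ne hr, bernsteinKernel_of_ne hr, mul_add,
      neg_add, Real.exp_add]
    ring

/-- The exponentials on the closed orthant as a character into bounded continuous functions. -/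
noncomputable def laplaceCharacter (n : ℕ) :
    Multiplicative (Fin n → ℝ≥0) →* BoundedContinuousFunction (Fin n → ℝ≥0) ℝ where
  toFun t := BoundedContinuousFunction.ofNormedAddCommGroup
    (fun r => ∏ i, Real.exp (-(r i * t.toAdd i))) (by fun_prop) 1 fun r => by
      rw [Real.norm_eq_abs, Finset.abs_prod]
      refine Finset.prod_le_one (fun i _ => abs_nonneg _) fun i _ => ?_
      rw [Real.abs_exp, Real.exp_le_one_iff]
      exact neg_nonpos.2 (by positivity)
  map_one' := by ext r; simp
  map_mul' s t := by
    ext r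
    simp [← Finset.prod_mul_distrib, ← Real.exp_add, mul_add, add_comm]

theorem laplaceCharacter_apply (t : Fin n → ℝ≥0) (r : Fin n → ℝ≥0) :
    laplaceCharacter n (Multiplicative.ofAdd t) r = ∏ i, Real.exp (-(r i * t i)) := rfl

/-- The algebra of exponential polynomials. -/
noncomputable def laplaceAlgebra (n : ℕ) :
    StarSubalgebra ℝ (BoundedContinuousFunction (Fin n → ℝ≥0) ℝ) :=
  { (AddMonoidAlgebra.lift ℝ _ _ (laplaceCharacter n)).range with
    star_mem' := fun {f} hf => by
      have : star f = f := by ext r; simp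
      rwa [this] }

/-- A finite measure on the closed orthant is determined by its Laplace transform. -/
theorem ext_of_laplace {μ ν : Measure (Fin n → ℝ≥0)} [IsFiniteMeasure μ] [IsFiniteMeasure ν]
    (h : ∀ t : Fin n → ℝ≥0, ∫ r, ∏ i, Real.exp (-(r i * t i)) ∂μ =
      ∫ r, ∏ i, Real.exp (-(r i * t i)) ∂ν) : μ = ν := by
  -- Exponential polynomials form an algebra of bounded continuous functions; the functions
  -- `e^{-r_i}` separate points.
  refine ext_of_forall_mem_subalgebra_integral_eq_of_polish (𝕜 := ℝ) (A := laplaceAlgebra n) ?_ ?_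
  · intro x y hxy
    obtain ⟨i, hi⟩ := Function.ne_iff.1 hxy
    refine ⟨_, ⟨_, ⟨_, ⟨AddMonoidAlgebra.single (Pi.single i 1) 1, rfl⟩, rfl⟩, rfl⟩, ?_⟩
    have e : ∀ z : Fin n → ℝ≥0, ∏ j, Real.exp (-(z j * (Pi.single i 1 : Fin n → ℝ≥0) j)) =
        Real.exp (-(z i)) := by
      intro z
      rw [Finset.prod_eq_single i]
      · simp
      · intro j _ hj; simp [hj]
      · simp
    intro he
    have he' : ∏ j, Real.exp (-(x j * (Pi.single i 1 : Fin n → ℝ≥0) j)) =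
        ∏ j, Real.exp (-(y j * (Pi.single i 1 : Fin n → ℝ≥0) j)) := by
      simpa [laplaceCharacter_apply] using he
    rw [e, e] at he'
    exact hi (by simpa using he')
  · rintro _ ⟨P, rfl⟩
    change ∫ r, (AddMonoidAlgebra.lift ℝ _ _ (laplaceCharacter n) P) r ∂μ =
      ∫ r, (AddMonoidAlgebra.lift ℝ _ _ (laplaceCharacter n) P) r ∂ν
    induction P using AddMonoidAlgebra.induction_linear with
    | zero => simp
    | add P Q hP hQ =>
      simp only [map_add, BoundedContinuousFunction.coe_add, Pi.add_apply]
      rw [integral_add (BoundedContinuousFunction.integrable _ _)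
        (BoundedContinuousFunction.integrable _ _),
        integral_add (BoundedContinuousFunction.integrable _ _)
        (BoundedContinuousFunction.integrable _ _), hP, hQ]
    | single a c =>
      simp only [AddMonoidAlgebra.lift_single, BoundedContinuousFunction.coe_smul,
        laplaceCharacter_apply, smul_eq_mul]
      rw [integral_const_mul, integral_const_mul, h]

/-- The value of the product kernel at the point `(1, …, 1)`. -/
noncomputable def unitWeight (r : Fin n → ℝ≥0) : ℝ≥0 :=
  Real.toNNReal (∏ i, bernsteinKernel (r i) 1)

theorem coe_unitWeight (r : Fin n → ℝ≥0) :
    (unitWeight r : ℝ) = ∏ i, bernsteinKernel (r i) 1 :=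
  Real.coe_toNNReal _ (Finset.prod_nonneg fun i _ =>
    zero_le_one.trans (one_le_bernsteinKernel_one (r i).2))

theorem unitWeight_ne_zero (r : Fin n → ℝ≥0) : unitWeight r ≠ 0 := by
  rw [← NNReal.coe_ne_zero, coe_unitWeight]
  exact (Finset.prod_pos fun i _ =>
    zero_lt_one.trans_le (one_le_bernsteinKernel_one (r i).2)).ne'

theorem measurable_unitWeight : Measurable (unitWeight (n := n)) :=
  (Finset.measurable_prod _ fun i _ => (measurable_bernsteinKernel 1).comp
    (measurable_coe_nnreal_real.comp (measurable_pi_apply i))).real_toNNReal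

theorem Represents.integral_exp_unitWeight {η : Measure (Fin n → ℝ≥0)} {g : (Fin n → ℝ) → ℝ}
    (h : Represents η g) (t : Fin n → ℝ≥0) :
    ∫ r, ∏ i, Real.exp (-(r i * t i)) ∂(η.withDensity fun r => (unitWeight r : ENNReal)) =
      act (boxElt 1) (g ∘ orthantIncl n) t := by
  have hg : g ∘ orthantIncl n = fun t : Fin n → ℝ≥0 =>
      ∫ r : Fin n → ℝ≥0, ∏ i, bernsteinKernel (r i) (t i) ∂η :=
    funext fun t => (h _ fun i => (t i).2).2
  have hint : ∀ t : Fin n → ℝ≥0, Integrable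
      (fun r : Fin n → ℝ≥0 => ∏ i, bernsteinKernel (r i) (t i)) η :=
    fun t => (h (orthantIncl n t) fun i => (t i).2).1
  rw [hg, (act_integral η hint (boxElt 1) t).2,
    integral_withDensity_eq_integral_smul measurable_unitWeight]
  refine integral_congr_ae (Filter.Eventually.of_forall fun r => ?_)
  have := act_boxElt_prod (fun i x => bernsteinKernel (r i) x) 1 t
  dsimp only
  refine Eq.trans ?_ this.symm
  rw [NNReal.smul_def, coe_unitWeight, smul_eq_mul, ← Finset.prod_mul_distrib]
  refine Finset.prod_congr rfl fun i _ => ?_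
  rw [Pi.one_apply, NNReal.coe_add, NNReal.coe_one, bernsteinKernel_add_one_sub, mul_comm]

/-- The weight is the product kernel at `(1, …, 1)`, which is integrable by assumption. -/
theorem Represents.isFiniteMeasure_withDensity {η : Measure (Fin n → ℝ≥0)}
    {g : (Fin n → ℝ) → ℝ} (h : Represents η g) :
    IsFiniteMeasure (η.withDensity fun r => (unitWeight r : ENNReal)) := by
  have := (h 1 fun _ => zero_le_one).1
  exact isFiniteMeasure_withDensity_ofReal this.2

/-- The weighted measures have the same Laplace transform, and the weight, finite and nowhere zero,
can be divided out. -/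
theorem Represents.unique {η₁ η₂ : Measure (Fin n → ℝ≥0)} {g : (Fin n → ℝ) → ℝ}
    (h₁ : Represents η₁ g) (h₂ : Represents η₂ g) : η₁ = η₂ := by
  have := h₁.isFiniteMeasure_withDensity
  have := h₂.isFiniteMeasure_withDensity
  have key : (η₁.withDensity fun r => (unitWeight r : ENNReal)) =
      η₂.withDensity fun r => (unitWeight r : ENNReal) :=
    ext_of_laplace fun t => by
      rw [h₁.integral_exp_unitWeight, h₂.integral_exp_unitWeight]
  have hinv : ∀ η : Measure (Fin n → ℝ≥0),
      ((η.withDensity fun r => (unitWeight r : ENNReal)).withDensity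
        (fun r => (unitWeight r : ENNReal))⁻¹) = η := fun η =>
    withDensity_inv_same measurable_unitWeight.coe_nnreal_ennreal
      (Filter.Eventually.of_forall fun r => by simpa using unitWeight_ne_zero r)
      (Filter.Eventually.of_forall fun r => ENNReal.coe_ne_top)
  rw [← hinv η₁, key, hinv]

end uniqueness

theorem mainTheorem6 (n : ℕ) (g : (Fin n → ℝ) → ℝ)
    (hg : ContinuousOn g (closedOrthant n))
    (hg0 : ∀ t ∈ orthantBoundary n, g t = 0) :
    (IsBernsteinOfOrderN g ↔
      ∃ η : Measure (Fin n → ℝ≥0), IsFiniteMeasure η ∧ Represents η g) ∧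
    (∀ η₁ η₂ : Measure (Fin n → ℝ≥0), IsFiniteMeasure η₁ → IsFiniteMeasure η₂ →
      Represents η₁ g → Represents η₂ g → η₁ = η₂) := by
  refine ⟨⟨fun h => ?_, fun ⟨η, hη, h⟩ => h.isBernsteinOfOrderN⟩, fun _ _ _ _ h₁ h₂ => h₁.unique h₂⟩
  obtain ⟨η, hη, hrep⟩ := exists_measure_of_mem_bernsteinCone (h.mem_bernsteinCone hg hg0)
    (continuous_comp_orthantIncl hg)
  refine ⟨η, hη, fun t ht => ?_⟩
  lift t to Fin n → ℝ≥0 using ht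
  exact hrep t
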